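/- **Setting.** Let $L$ be a first-order vocabulary and let $\Theta$ be a countable set of first-order $L$-formulas $\theta(\bar x,\bar y)$, each given with a splitting of its free variables into object variables $\bar x$ (at least one; their number is the *arity* of $\theta$) and parameter variables $\bar y$. For a nonempty $L$-structure $\mathfrak A$ let $K^A_\Theta$ be the collection of all relations $\{\bar d\mid \mathfrak A\models\theta[\bar d,\bar e]\}$ with $\theta\in\Theta$ and $\bar e$ a sequence of elements of $A$; then $(\mathfrak A,K_\Theta^A)$ is called a *standard structure*. The language $\mathcal L^2_\Theta$ has the atomic formulas of first-order logic with identity and countably many relation variables $V_0,V_1,\dots$ of each arity that occurs in $\Theta$, with atoms $V_m(\bar t)$ and $V_m=V_n$; it is closed under $\neg$, $\wedge$, $\forall x$ and $\forall V$. In a standard structure, relation variables of arity $k$ range over the $k$-ary members of $K^A_\Theta$. For a formula $\varphi$, a relation variable $V$ and $\theta\in\Theta$ of the same arity, $\varphi(V/\theta(\cdot,\bar z))$ is the result of replacing (without capture) the free occurrences $V(\bar t)$ by $\theta(\bar t,\bar z)$, and identities $V=W$ by $\forall\bar x(\theta(\bar x,\bar z)\leftrightarrow W(\bar x))$; $\varphi_\theta$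 is $\forall\bar y\,\varphi(V/\theta(\cdot,\bar y))$ with fresh $\bar y$. Let $\vdash$ be derivability, by deductions of countable length, from premises and from: a complete set of axioms for first-order logic with identity; $\forall\bar y\exists V\forall\bar x(V(\bar x)\leftrightarrow\theta(\bar x,\bar y))$ for $\theta\in\Theta$; $\forall V,W(\forall\bar x(V(\bar x)\leftrightarrow W(\bar x))\leftrightarrow V=W)$; $\forall V,W(V=W\to(\varphi\to\varphi'))$, where $\varphi'$ arises from $\varphi$ by replacing some occurrences of $V$ by $W$; $\forall V\varphi\to\varphi(V/W)$; $\forall V(\varphi\to\psi)\to(\varphi\to\forall V\psi)$ with $V$ not free in $\varphi$; $\forall V\varphi\to\varphi_\theta$ for $\theta\in\Theta$ of the arity of $V$; with the rules modus ponens, generalization for both kinds of variables, and the infinitary rule: from $\psi\to\varphi_\theta$ for all $\theta\in\Theta$ of the arity of $V$, infer $\psi\to\forall V\varphi$. **Theorem (Model Existence).** Let $\Sigma\cup\{\varphi\}$ be a countable set of $\mathcal L^2_\Theta$-sentences with $\Sigma\nvdash\varphi$. Then there is a standard structure $(\mathfrak A,K^A_\Theta)$ with $(\mathfrak A,K^A_\Theta)\models\Sigma$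 and $(\mathfrak A,K^A_\Theta)\not\models\varphi$. Moreover, suppose that $L$ is countable. Let $\mathscr L(\Sigma)$ be the Lindenbaum algebra of classes $\llbracket\psi\rrbracket$ of $\mathcal L^2_\Theta$-formulas modulo $\Sigma$-provable equivalence, and let $\mathcal F$ be the family of all subsets of $\mathscr L(\Sigma)$ of one of the forms $\{\llbracket\psi(x/x_m)\rrbracket\mid m\in\omega\}$, $\{\llbracket\psi(V/V_m)\rrbracket\mid m\in\omega\}$, and $\{\llbracket\psi(V/\theta(\cdot,\bar z))\rrbracket\mid \theta\in\Theta$ of the arity of $V$, $\bar z$ first-order variables$\}$. Then $\mathcal F$ is countable, each member of $\mathcal F$ has a join and a meet, and there is an ultrafilter $U$ of $\mathscr L(\Sigma)$ with $\llbracket\varphi\rrbracket\notin U$ which is $\mathcal F$-compatible (for $S\in\mathcal F$: $\bigvee S\in U$ iff $S\cap U\ne\emptyset$, and $\bigwedge S\in U$ iff $S\subseteq U$) such that $\mathfrak A$ can be taken to be the canonical structure of $U$: its elements are the classes $\hat x$ of first-order variables, with $\hat x=\hat y$ iff $\llbracket x=y\rrbracket\in U$; $R(\hat x_1,\dots,\hat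 x_n)$ holds iff $\llbracket R(x_1,\dots,x_n)\rrbracket\in U$; and $f(\hat x_1,\dots,\hat x_n)=\hat y$ iff $\llbracket f(x_1,\dots,x_n)=y\rrbracket\in U$. For each arity that occurs in $\Theta$, the members of $K^A_\Theta$ of that arity are exactly the relations $F_m=\{(\hat x_0,\dots,\hat x_l)\mid\llbracket V_m(x_0,\dots,x_l)\rrbracket\in U\}$. -/

import Mathlib

open FirstOrder FirstOrder.Language

universe u v w

namespace RestrictedSO


/-- A first-order formula `θ(x̄, ȳ)` together with the splitting of its free variables into the
`l + 1` object variables `x̄` and finitely many parameter variables `ȳ`. -/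
structure DefFormula (L : FirstOrder.Language.{u, v}) (l : ℕ) where
  params : ℕ
  formula : L.Formula (Fin (l + 1) ⊕ Fin params)

/-- A set `Θ` of first-order formulas, sorted by the arity of the relations they define:
`Θ l` consists of the members of `Θ` that define relations of arity `l + 1`. -/
abbrev DefClass (L : FirstOrder.Language.{u, v}) : Type (max u v) := ∀ l : ℕ, Set (DefFormula L l)

/-- The collection `K_Θ^A` of the relations (of arity `l + 1`) on `A` that are definable, with
parameters substituted for `ȳ`, by a formula of `Θ`. -/
def definableRels {L : FirstOrder.Language.{u, v}} (Θ : DefClass L) (A : Type w) [L.Structure A] (l : ℕ) :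
    Set (Set (Fin (l + 1) → A)) :=
  {B | ∃ θ ∈ Θ l, ∃ e : Fin θ.params → A, B = {d | θ.formula.Realize (Sum.elim d e)}}

/-- The sorts of relation variables: `l` stands for the arity `l + 1`, and there are relation
variables of this arity iff some member of `Θ` defines relations of this arity. -/
abbrev RelSort {L : FirstOrder.Language.{u, v}} (Θ : DefClass L) : Type := {l : ℕ // (Θ l).Nonempty}

/-- Formulas of the restricted second-order language, with De Bruijn indices: first-order variables
are natural numbers, relation variables of sort `l` are natural numbers (counted separately for each
sort), `all` binds the first-order variable `0`, and `allR l` binds the relation variable `0` of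
sort `l`.  The atom `req l i j` is the identity `V_i = V_j` of relation variables. -/
inductive Fml {L : FirstOrder.Language.{u, v}} (Θ : DefClass L) : Type (max u v)
  | equal (t s : L.Term ℕ) : Fml Θ
  | rel {n : ℕ} (R : L.Relations n) (ts : Fin n → L.Term ℕ) : Fml Θ
  | rvar (l : RelSort Θ) (i : ℕ) (ts : Fin (l.1 + 1) → L.Term ℕ) : Fml Θ
  | req (l : RelSort Θ) (i j : ℕ) : Fml Θ
  | neg (φ : Fml Θ) : Fml Θ
  | and (φ ψ : Fml Θ) : Fml Θ
  | all (φ : Fml Θ) : Fml Θ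
  | allR (l : RelSort Θ) (φ : Fml Θ) : Fml Θ

section Semantics

variable {L : FirstOrder.Language.{u, v}} {Θ : DefClass L} {A : Type w}

/-- The assignment that sends variable `0` to `a` and variable `n + 1` to `s n`. -/
def consVal {X : Type w} (a : X) (s : ℕ → X) : ℕ → X
  | 0 => a
  | n + 1 => s n

/-- The same for relation variables of sort `l`; the other sorts are not affected. -/
def consRel (l : RelSort Θ) (B : Set (Fin (l.1 + 1) → A))
    (S : ∀ k : RelSort Θ, ℕ → Set (Fin (k.1 + 1) → A)) :
    ∀ k : RelSort Θ, ℕ → Set (Fin (k.1 + 1) → A) :=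
  Function.update S l (consVal B (S l))

/-- Satisfaction in `(A, K)`, the relation quantifiers ranging over `K`. -/
def Sat [L.Structure A] (K : ∀ l : ℕ, Set (Set (Fin (l + 1) → A))) :
    (ℕ → A) → (∀ k : RelSort Θ, ℕ → Set (Fin (k.1 + 1) → A)) → Fml Θ → Prop
  | s, _, .equal t t' => t.realize s = t'.realize s
  | s, _, .rel R ts => Structure.RelMap R (fun i => (ts i).realize s)
  | s, S, .rvar l i ts => (fun j => (ts j).realize s) ∈ S l i
  | _, S, .req l i j => S l i = S l j
  | s, S, .neg φ => ¬ Sat K s S φ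
  | s, S, .and φ ψ => Sat K s S φ ∧ Sat K s S ψ
  | s, S, .all φ => ∀ a : A, Sat K (consVal a s) S φ
  | s, S, .allR l φ => ∀ B ∈ K l.1, Sat K s (consRel l B S) φ

/-- Truth of a formula in the standard structure `(A, K_Θ^A)`: it is satisfied under all assignments
of elements of `A` to first-order variables and of members of `K_Θ^A` to relation variables. -/
def StdModels (A : Type w) [L.Structure A] (φ : Fml Θ) : Prop :=
  ∀ (s : ℕ → A) (S : ∀ k : RelSort Θ, ℕ → Set (Fin (k.1 + 1) → A)),
    (∀ k i, S k i ∈ definableRels Θ A k.1) → Sat (definableRels Θ A) s S φ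

end Semantics

section Calculus

variable {L : FirstOrder.Language.{u, v}} {Θ : DefClass L}

namespace Fml

/-- The free first-order variables. -/
def freeVars : Fml Θ → Set ℕ
  | equal t s => {x | x ∈ t.varFinset ∨ x ∈ s.varFinset}
  | rel _ ts => {x | ∃ i, x ∈ (ts i).varFinset}
  | rvar _ _ ts => {x | ∃ i, x ∈ (ts i).varFinset}
  | req _ _ _ => ∅
  | neg φ => freeVars φ
  | and φ ψ => freeVars φ ∪ freeVars ψ
  | all φ => {x | x + 1 ∈ freeVars φ}
  | allR _ φ => freeVars φ

/-- The free relation variables (as pairs of a sort and an index). -/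
def freeRelVars : Fml Θ → Set (RelSort Θ × ℕ)
  | equal _ _ => ∅
  | rel _ _ => ∅
  | rvar l i _ => {(l, i)}
  | req l i j => {(l, i), (l, j)}
  | neg φ => freeRelVars φ
  | and φ ψ => freeRelVars φ ∪ freeRelVars ψ
  | all φ => freeRelVars φ
  | allR l φ => {p | (if p.1 = l then (p.1, p.2 + 1) else p) ∈ freeRelVars φ}

/-- A sentence has no free variables of either kind. -/
def IsSentence (φ : Fml Θ) : Prop := φ.freeVars = ∅ ∧ φ.freeRelVars = ∅

def imp (φ ψ : Fml Θ) : Fml Θ := neg (and φ (neg ψ))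
def or (φ ψ : Fml Θ) : Fml Θ := neg (and (neg φ) (neg ψ))
def iff (φ ψ : Fml Θ) : Fml Θ := and (imp φ ψ) (imp ψ φ)
def exR (l : RelSort Θ) (φ : Fml Θ) : Fml Θ := neg (allR l (neg φ))
/-- The truth constant `∀ x, x = x`. -/
def top : Fml Θ := all (equal (Term.var 0) (Term.var 0))
def bot : Fml Θ := neg top

/-- A string of `n` first-order universal quantifiers, binding the variables `0, …, n - 1`. -/
def allN : ℕ → Fml Θ → Fml Θ
  | 0, φ => φ
  | n + 1, φ => all (allN n φ)

/-- The substitution `σ` moved under a first-order quantifier. -/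
def upSubst (σ : ℕ → L.Term ℕ) : ℕ → L.Term ℕ :=
  consVal (Term.var 0) (fun n => (σ n).relabel Nat.succ)

/-- Simultaneous (capture-avoiding) substitution of terms for the free first-order variables. -/
def subst : (ℕ → L.Term ℕ) → Fml Θ → Fml Θ
  | σ, equal t s => equal (t.subst σ) (s.subst σ)
  | σ, rel R ts => rel R (fun i => (ts i).subst σ)
  | σ, rvar l i ts => rvar l i (fun j => (ts j).subst σ)
  | _, req l i j => req l i j
  | σ, neg φ => neg (subst σ φ)
  | σ, and φ ψ => and (subst σ φ) (subst σ ψ)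
  | σ, all φ => all (subst (upSubst σ) φ)
  | σ, allR l φ => allR l (subst σ φ)

/-- Renaming `x_i ↦ x_{i + n}` of the free first-order variables. -/
def shift (n : ℕ) (φ : Fml Θ) : Fml Θ := φ.subst (fun i => Term.var (i + n))

/-- `φ[t / x_0]`, the other free variables being moved down: the instance of `∀ x φ` at `t`. -/
def inst (t : L.Term ℕ) (φ : Fml Θ) : Fml Θ := φ.subst (consVal t Term.var)

/-- A first-order formula, with terms `a` for its free variables and `b` for its dangling bound
variables, as a formula of the restricted second-order language. -/
def ofFirstOrder {α : Type} : {n : ℕ} → L.BoundedFormula α n → (α → L.Term ℕ) →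
    (Fin n → L.Term ℕ) → Fml Θ
  | _, .falsum, _, _ => bot
  | _, .equal t s, a, b => equal (t.subst (Sum.elim a b)) (s.subst (Sum.elim a b))
  | _, .rel R ts, a, b => rel R (fun i => (ts i).subst (Sum.elim a b))
  | _, .imp φ ψ, a, b => imp (ofFirstOrder φ a b) (ofFirstOrder ψ a b)
  | _, .all φ, a, b => all (ofFirstOrder φ (fun i => (a i).relabel Nat.succ)
      (Fin.snoc (fun i => (b i).relabel Nat.succ) (Term.var 0)))

end Fml

/-- The formula `θ(t̄, ē)`. -/
def DefFormula.app {l : ℕ} (θ : DefFormula L l) (ts : Fin (l + 1) → L.Term ℕ)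
    (e : Fin θ.params → L.Term ℕ) : Fml Θ :=
  Fml.ofFirstOrder θ.formula (Sum.elim ts e) Fin.elim0

/-- What may be substituted for a relation variable of sort `l`: a relation variable of the same
sort, or a formula `θ(·, ē)` with terms `ē` for its parameters. -/
inductive RelExpr (Θ : DefClass L) (l : RelSort Θ) : Type (max u v)
  | var (i : ℕ) : RelExpr Θ l
  | defn (θ : DefFormula L l.1) (e : Fin θ.params → L.Term ℕ) : RelExpr Θ l

namespace RelExpr

variable {l : RelSort Θ}

/-- Application of a relation expression to terms. -/
def app : RelExpr Θ l → (Fin (l.1 + 1) → L.Term ℕ) → Fml Θ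
  | var i, ts => .rvar l i ts
  | defn θ e, ts => θ.app ts e

/-- Renaming `x_i ↦ x_{i + n}` of the first-order variables. -/
def shift (n : ℕ) : RelExpr Θ l → RelExpr Θ l
  | var i => var i
  | defn θ e => defn θ (fun j => (e j).relabel (· + n))

/-- Renaming `V_i ↦ V_{i + 1}` of the relation variables of sort `l`. -/
def shiftR : RelExpr Θ l → RelExpr Θ l
  | var i => var (i + 1)
  | defn θ e => defn θ e

/-- The formula `∀ x̄ (E x̄ ↔ E' x̄)`. -/
def coext (E E' : RelExpr Θ l) : Fml Θ :=
  Fml.allN (l.1 + 1) (Fml.iff ((E.shift (l.1 + 1)).app (fun j => Term.var j.1))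
    ((E'.shift (l.1 + 1)).app (fun j => Term.var j.1)))

/-- Identity of relation expressions: the primitive identity between relation variables, and
coextensiveness when one of the sides is a first-order formula. -/
def eq : RelExpr Θ l → RelExpr Θ l → Fml Θ
  | var i, var j => .req l i j
  | E, E' => coext E E'

end RelExpr

/-- The substitution `τ` moved under the quantifier `allR l`. -/
def upSubstR (l : RelSort Θ) (τ : ∀ k : RelSort Θ, ℕ → RelExpr Θ k) :
    ∀ k : RelSort Θ, ℕ → RelExpr Θ k :=
  Function.update τ l (consVal (RelExpr.var 0) (fun i => (τ l i).shiftR))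

/-- The substitution of `E` for the relation variable `0` of sort `l`, the other relation variables
of sort `l` being moved down. -/
def instSubstR (l : RelSort Θ) (E : RelExpr Θ l) : ∀ k : RelSort Θ, ℕ → RelExpr Θ k :=
  Function.update (fun _ => RelExpr.var) l (consVal E RelExpr.var)

namespace Fml

/-- Simultaneous (capture-avoiding) substitution for the free relation variables. -/
def substR : (∀ k : RelSort Θ, ℕ → RelExpr Θ k) → Fml Θ → Fml Θ
  | _, equal t s => equal t s
  | _, rel R ts => rel R ts
  | τ, rvar l i ts => (τ l i).app ts
  | τ, req l i j => (τ l i).eq (τ l j)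
  | τ, neg φ => neg (substR τ φ)
  | τ, and φ ψ => and (substR τ φ) (substR τ ψ)
  | τ, all φ => all (substR (fun k i => (τ k i).shift 1) φ)
  | τ, allR l φ => allR l (substR (upSubstR l τ) φ)

/-- The instance of `∀ V φ` (with `V` of sort `l`) at the relation expression `E`. -/
def instR (l : RelSort Θ) (E : RelExpr Θ l) (φ : Fml Θ) : Fml Θ := φ.substR (instSubstR l E)

/-- Renaming `V_i ↦ V_{i + 1}` of the free relation variables of sort `l`. -/
def shiftR (l : RelSort Θ) (φ : Fml Θ) : Fml Θ :=
  φ.substR (Function.update (fun _ => RelExpr.var) l (fun i => RelExpr.var (i + 1)))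

/-- The formula `∀ ȳ φ(θ(·, ȳ))`: the relation variable `0` of sort `l` is replaced by `θ(·, ȳ)`, and
the parameters `ȳ`, as new variables, are universally quantified. -/
def repl (l : RelSort Θ) (θ : DefFormula L l.1) (φ : Fml Θ) : Fml Θ :=
  allN θ.params ((φ.shift θ.params).instR l (.defn θ (fun j => Term.var j.1)))

/-- Tautologies: formulas true under every two-valued valuation that respects `¬` and `∧`. -/
def IsTautology (φ : Fml Θ) : Prop :=
  ∀ v : Fml Θ → Prop, (∀ ψ, v (neg ψ) ↔ ¬ v ψ) → (∀ ψ χ, v (and ψ χ) ↔ v ψ ∧ v χ) → v φ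

end Fml

open Fml in
/-- Logical axioms. -/
inductive Axm : Fml Θ → Prop
  /- A complete set of axioms for first-order logic with identity. -/
  | taut (φ : Fml Θ) : φ.IsTautology → Axm φ
  | allInst (φ : Fml Θ) (t : L.Term ℕ) : Axm ((all φ).imp (φ.inst t))
  | allImp (φ ψ : Fml Θ) : Axm ((all ((φ.shift 1).imp ψ)).imp (φ.imp (all ψ)))
  | eqRefl (t : L.Term ℕ) : Axm (equal t t)
  | eqSubst (φ : Fml Θ) (t s : L.Term ℕ) : Axm ((equal t s).imp ((φ.inst t).imp (φ.inst s)))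
  /- Comprehension: `∀ ȳ ∃ V ∀ x̄ (V x̄ ↔ θ(x̄, ȳ))`. -/
  | comprehension (l : RelSort Θ) (θ : DefFormula L l.1) : θ ∈ Θ l.1 →
      Axm (allN θ.params (exR l (allN (l.1 + 1)
        ((rvar l 0 (fun j => Term.var j.1)).iff
          (θ.app (fun j => Term.var j.1) (fun j => Term.var (j.1 + (l.1 + 1))))))))
  /- Extensionality: `∀ V W (∀ x̄ (V x̄ ↔ W x̄) ↔ V = W)`. -/
  | extensionality (l : RelSort Θ) :
      Axm (allR l (allR l ((allN (l.1 + 1)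
        ((rvar l 1 (fun j => Term.var j.1)).iff (rvar l 0 (fun j => Term.var j.1)))).iff
          (req l 1 0))))
  /- Leibniz's law: `∀ V W (V = W → (φ(V) → φ(W)))`; the replaced occurrences are marked by an
  auxiliary relation variable of `φ`. -/
  | leibniz (l : RelSort Θ) (φ : Fml Θ) :
      Axm (allR l (allR l ((req l 1 0).imp ((φ.instR l (.var 1)).imp (φ.instR l (.var 0))))))
  /- Quantifier principles. -/
  | allRInst (l : RelSort Θ) (φ : Fml Θ) (j : ℕ) : Axm ((allR l φ).imp (φ.instR l (.var j)))
  | allRImp (l : RelSort Θ) (φ ψ : Fml Θ) :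
      Axm ((allR l ((φ.shiftR l).imp ψ)).imp (φ.imp (allR l ψ)))
  | allRRepl (l : RelSort Θ) (φ : Fml Θ) (θ : DefFormula L l.1) : θ ∈ Θ l.1 →
      Axm ((allR l φ).imp (φ.repl l θ))

/-- Derivability from a set of premises, in the calculus with the infinitary rule `omegaRule`. -/
inductive Provable (Γ : Set (Fml Θ)) : Fml Θ → Prop
  | premise {φ : Fml Θ} : φ ∈ Γ → Provable Γ φ
  | ax {φ : Fml Θ} : Axm φ → Provable Γ φ
  | mp {φ ψ : Fml Θ} : Provable Γ (φ.imp ψ) → Provable Γ φ → Provable Γ ψ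
  | gen {φ : Fml Θ} : Provable Γ φ → Provable Γ (.all φ)
  | genR (l : RelSort Θ) {φ : Fml Θ} : Provable Γ φ → Provable Γ (.allR l φ)
  | omegaRule (l : RelSort Θ) {φ ψ : Fml Θ} :
      (∀ θ ∈ Θ l.1, Provable Γ (ψ.imp (φ.repl l θ))) → Provable Γ (ψ.imp (.allR l φ))

end Calculus

section Lindenbaum

variable {L : FirstOrder.Language.{u, v}} {Θ : DefClass L} (Γ : Set (Fml Θ))

theorem Provable.of_taut {Γ : Set (Fml Θ)} {φ : Fml Θ}
    (h : ∀ v : Fml Θ → Prop, (∀ ψ, v (.neg ψ) ↔ ¬ v ψ) →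
      (∀ ψ χ, v (.and ψ χ) ↔ v ψ ∧ v χ) → v φ) : Provable Γ φ := .ax (.taut φ h)

theorem Provable.of_taut₁ {Γ : Set (Fml Θ)} {φ ψ : Fml Θ} (hφ : Provable Γ φ)
    (h : ∀ v : Fml Θ → Prop, (∀ ψ, v (.neg ψ) ↔ ¬ v ψ) →
      (∀ ψ χ, v (.and ψ χ) ↔ v ψ ∧ v χ) → v φ → v ψ) : Provable Γ ψ := by
  refine .mp (.of_taut fun v hn ha => ?_) hφ
  have := h v hn ha
  simp only [Fml.imp, hn, ha]; tauto

theorem Provable.of_taut₂ {Γ : Set (Fml Θ)} {φ ψ χ : Fml Θ} (hφ : Provable Γ φ)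
    (hψ : Provable Γ ψ)
    (h : ∀ v : Fml Θ → Prop, (∀ ψ, v (.neg ψ) ↔ ¬ v ψ) →
      (∀ ψ χ, v (.and ψ χ) ↔ v ψ ∧ v χ) → v φ → v ψ → v χ) : Provable Γ χ := by
  refine .mp (.of_taut₁ hφ fun v hn ha => ?_) hψ
  have := h v hn ha
  simp only [Fml.imp, hn, ha]; tauto

/-- Provable equivalence `Γ ⊢ φ ↔ ψ`. -/
def provSetoid : Setoid (Fml Θ) where
  r φ ψ := Provable Γ (φ.iff ψ)
  iseqv :=
    { refl := fun φ => .of_taut fun v hn ha => by simp only [Fml.iff, Fml.imp, hn, ha]; tauto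
      symm := fun h => .of_taut₁ h fun v hn ha => by simp only [Fml.iff, Fml.imp, hn, ha]; tauto
      trans := fun h h' => .of_taut₂ h h' fun v hn ha => by
        simp only [Fml.iff, Fml.imp, hn, ha]; tauto }

/-- The Lindenbaum algebra of `Γ`. -/
def Lindenbaum : Type (max u v) := Quotient (provSetoid Γ)

/-- The class of a formula in the Lindenbaum algebra. -/
def cls (φ : Fml Θ) : Lindenbaum Γ := Quotient.mk (provSetoid Γ) φ

instance : LE (Lindenbaum Γ) where
  le := Quotient.lift₂ (fun φ ψ => Provable Γ (φ.imp ψ)) (by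
    intro φ ψ φ' ψ' h h'
    refine propext ⟨fun k => ?_, fun k => ?_⟩
    · exact Provable.of_taut₂ (.of_taut₂ h h' (χ := (φ.iff φ').and (ψ.iff ψ')) fun v hn ha => by
        simp only [ha]; tauto) k fun v hn ha => by simp only [Fml.iff, Fml.imp, hn, ha]; tauto
    · exact Provable.of_taut₂ (.of_taut₂ h h' (χ := (φ.iff φ').and (ψ.iff ψ')) fun v hn ha => by
        simp only [ha]; tauto) k fun v hn ha => by simp only [Fml.iff, Fml.imp, hn, ha]; tauto)

theorem cls_le_cls {φ ψ : Fml Θ} : cls Γ φ ≤ cls Γ ψ ↔ Provable Γ (φ.imp ψ) := Iff.rfl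

/-- The Lindenbaum algebra is a Boolean algebra under the operations induced by the connectives,
with the order `⟦φ⟧ ≤ ⟦ψ⟧` iff `Γ ⊢ φ → ψ`. -/
instance : BooleanAlgebra (Lindenbaum Γ) where
  sup := Quotient.map₂ Fml.or (by
    intro φ φ' h ψ ψ' h'
    exact Provable.of_taut₂ h h' fun v hn ha => by simp only [Fml.or, Fml.iff, Fml.imp, hn, ha]; tauto)
  inf := Quotient.map₂ Fml.and (by
    intro φ φ' h ψ ψ' h'
    exact Provable.of_taut₂ h h' fun v hn ha => by simp only [Fml.iff, Fml.imp, hn, ha]; tauto)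
  compl := Quotient.map Fml.neg (by
    intro φ φ' h
    exact Provable.of_taut₁ h fun v hn ha => by simp only [Fml.iff, Fml.imp, hn, ha]; tauto)
  top := cls Γ Fml.top
  bot := cls Γ Fml.bot
  le_refl := by
    rintro ⟨φ⟩
    exact Provable.of_taut fun v hn ha => by simp only [Fml.imp, hn, ha]; tauto
  le_trans := by
    rintro ⟨φ⟩ ⟨ψ⟩ ⟨χ⟩ h h'
    exact Provable.of_taut₂ h h' fun v hn ha => by simp only [Fml.imp, hn, ha]; tauto
  le_antisymm := by
    rintro ⟨φ⟩ ⟨ψ⟩ h h'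
    exact Quotient.sound (s := provSetoid Γ) (.of_taut₂ h h' fun v hn ha => by
      simp only [Fml.iff, Fml.imp, hn, ha]; tauto)
  le_sup_left := by
    rintro ⟨φ⟩ ⟨ψ⟩
    exact Provable.of_taut fun v hn ha => by simp only [Fml.or, Fml.imp, hn, ha]; tauto
  le_sup_right := by
    rintro ⟨φ⟩ ⟨ψ⟩
    exact Provable.of_taut fun v hn ha => by simp only [Fml.or, Fml.imp, hn, ha]; tauto
  sup_le := by
    rintro ⟨φ⟩ ⟨ψ⟩ ⟨χ⟩ h h'
    exact Provable.of_taut₂ h h' fun v hn ha => by simp only [Fml.or, Fml.imp, hn, ha]; tauto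
  inf_le_left := by
    rintro ⟨φ⟩ ⟨ψ⟩
    exact Provable.of_taut fun v hn ha => by simp only [Fml.imp, hn, ha]; tauto
  inf_le_right := by
    rintro ⟨φ⟩ ⟨ψ⟩
    exact Provable.of_taut fun v hn ha => by simp only [Fml.imp, hn, ha]; tauto
  le_inf := by
    rintro ⟨φ⟩ ⟨ψ⟩ ⟨χ⟩ h h'
    exact Provable.of_taut₂ h h' fun v hn ha => by simp only [Fml.imp, hn, ha]; tauto
  le_sup_inf := by
    rintro ⟨φ⟩ ⟨ψ⟩ ⟨χ⟩
    exact Provable.of_taut fun v hn ha => by simp only [Fml.or, Fml.imp, hn, ha]; tauto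
  inf_compl_le_bot := by
    rintro ⟨φ⟩
    exact Provable.of_taut fun v hn ha => by simp only [Fml.imp, hn, ha]; tauto
  top_le_sup_compl := by
    rintro ⟨φ⟩
    exact Provable.of_taut fun v hn ha => by simp only [Fml.or, Fml.imp, hn, ha]; tauto
  le_top := by
    rintro ⟨φ⟩
    exact Provable.of_taut₁ (.gen (.ax (.eqRefl (Term.var 0)))) fun v hn ha => by
      simp only [Fml.top, Fml.imp, hn, ha]; tauto
  bot_le := by
    rintro ⟨φ⟩
    exact Provable.of_taut₁ (.gen (.ax (.eqRefl (Term.var 0)))) fun v hn ha => by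
      simp only [Fml.bot, Fml.top, Fml.imp, hn, ha]; tauto

end Lindenbaum

section BooleanNotions

variable {B : Type w} [BooleanAlgebra B]

/-- Ultrafilters of a Boolean algebra. -/
structure IsUltrafilter (U : Set B) : Prop where
  top_mem : ⊤ ∈ U
  bot_notMem : ⊥ ∉ U
  inf_mem : ∀ a ∈ U, ∀ b ∈ U, a ⊓ b ∈ U
  mem_of_le : ∀ a ∈ U, ∀ b, a ≤ b → b ∈ U
  mem_or_compl_mem : ∀ a, a ∈ U ∨ aᶜ ∈ U

/-- A family of subsets is regular if each of its members has a join and a meet. -/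
def IsRegularFamily (F : Set (Set B)) : Prop :=
  ∀ S ∈ F, (∃ a, IsLUB S a) ∧ (∃ a, IsGLB S a)

/-- `U` respects the joins and meets of the members of `F`. -/
def IsCompatible (F : Set (Set B)) (U : Set B) : Prop :=
  ∀ S ∈ F, (∀ a, IsLUB S a → (a ∈ U ↔ (S ∩ U).Nonempty)) ∧ (∀ a, IsGLB S a → (a ∈ U ↔ S ⊆ U))

end BooleanNotions

section Canonical

variable {L : FirstOrder.Language.{u, v}} {Θ : DefClass L} (Γ : Set (Fml Θ))

/-- The family of the sets of all instances of a quantified formula: the instances of `∀ x ψ` at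
first-order variables, those of `∀ V ψ` at relation variables, and those of `∀ V ψ` at the formulas
`θ(·, z̄)` with `θ ∈ Θ` and first-order variables `z̄` as parameters. -/
def instFamily : Set (Set (Lindenbaum Γ)) :=
  {S | ∃ ψ : Fml Θ, S = {a | ∃ m : ℕ, a = cls Γ (ψ.inst (Term.var m))}} ∪
  {S | ∃ (l : RelSort Θ) (ψ : Fml Θ), S = {a | ∃ m : ℕ, a = cls Γ (ψ.instR l (.var m))}} ∪
  {S | ∃ (l : RelSort Θ) (ψ : Fml Θ), S = {a | ∃ θ ∈ Θ l.1, ∃ z : Fin θ.params → ℕ,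
    a = cls Γ (ψ.instR l (.defn θ (fun j => Term.var (z j))))}}

variable {Γ} (U : Set (Lindenbaum Γ))

/-- The domain of the canonical model: first-order variables, where `x` and `y` are identified
when `⟦x = y⟧ ∈ U`. -/
def CanonicalDomain : Type :=
  Quot (fun x y : ℕ => cls Γ (.equal (Term.var x) (Term.var y)) ∈ U)

/-- The class `x̂` of a first-order variable. -/
def hat (x : ℕ) : CanonicalDomain U := Quot.mk _ x

instance : Nonempty (CanonicalDomain U) := ⟨hat U 0⟩

/-- The canonical model: `R(x̂₁, …, x̂ₙ)` iff `⟦R(x₁, …, xₙ)⟧ ∈ U`, and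
`f(x̂₁, …, x̂ₙ) = ŷ` iff `⟦f(x₁, …, xₙ) = y⟧ ∈ U`. -/
noncomputable instance canonicalStructure : L.Structure (CanonicalDomain U) where
  funMap {_} f a := Classical.epsilon fun b => ∃ (x : Fin _ → ℕ) (y : ℕ),
    a = (fun i => hat U (x i)) ∧ b = hat U y ∧
      cls Γ (.equal (Term.func f (fun i => Term.var (x i))) (Term.var y)) ∈ U
  RelMap {_} R a := ∃ x : Fin _ → ℕ,
    a = (fun i => hat U (x i)) ∧ cls Γ (.rel R (fun i => Term.var (x i))) ∈ U

/-- The relation `F_m = {(x̂₀, …, x̂ₗ) | ⟦V_m(x₀, …, xₗ)⟧ ∈ U}` that interprets `V_m`. -/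
def canonicalRel (l : RelSort Θ) (m : ℕ) : Set (Fin (l.1 + 1) → CanonicalDomain U) :=
  {a | ∃ x : Fin (l.1 + 1) → ℕ,
    a = (fun i => hat U (x i)) ∧ cls Γ (.rvar l m (fun i => Term.var (x i))) ∈ U}

end Canonical

end RestrictedSO

/-! The proof is a Rasiowa–Sikorski argument. In the Lindenbaum algebra `⟦∀ x ψ⟧` is the meet of the
instances at first-order variables, because some variable is always fresh; likewise `⟦∀ V ψ⟧` is the
meet of the instances at relation variables. The infinitary rule makes `⟦∀ V ψ⟧` also the meet of
the instances at the formulas `θ(·, z̄)`. These facts are `isGLB_inst`, `isGLB_instR_var` and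
`isGLB_instR_defn`. As `φ` is not provable, its class is not `⊤`, and
`exists_ultrafilter_isCompatible` gives an ultrafilter `U` that omits it and respects countably many
of these meets.

In the canonical structure of `U` the relations `F_m` are exactly the definable ones. By
comprehension and the meet over relation variables, every relation defined by some `θ` with
parameters is an `F_m`. Conversely, `∀ V ¬ ∀ x̄ (V x̄ ↔ V_m x̄)` is not in `U`, since it fails at
`V_m` itself; by the meet over the `θ(·, z̄)`, one of these is coextensive with `V_m` according to
`U`. Truth then amounts to membership in `U`, by induction on formulas (`IsGeneric.sat_iff`).

For uncountable `L`, only the meets of formulas over a countable set `S` of symbols are respected,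
where `S` covers `Θ`, `Γ` and `φ`. The calculus and the algebra keep the full language, so no
conservativity over a sublanguage is needed. -/

namespace RestrictedSO

/-! ### Algebra of substitutions for first-order and relation variables. -/

section Substitution

variable {L : FirstOrder.Language.{u, v}} {Θ : DefClass L}

theorem _root_.FirstOrder.Language.Term.subst_subst {α β γ : Type*} (t : L.Term α)
    (σ : α → L.Term β) (τ : β → L.Term γ) :
    (t.subst σ).subst τ = t.subst fun i => (σ i).subst τ := by
  induction t with
  | var => rfl
  | func f ts ih => simp [Term.subst, ih]

theorem _root_.FirstOrder.Language.Term.subst_var {α : Type*} (t : L.Term α) :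
    t.subst Term.var = t := by
  induction t with
  | var => rfl
  | func f ts ih => simp [Term.subst, ih]

theorem _root_.FirstOrder.Language.Term.relabel_eq_subst {α β : Type*} (t : L.Term α) (g : α → β) :
    t.relabel g = t.subst fun i => Term.var (g i) := by
  induction t with
  | var => rfl
  | func f ts ih => simp [Term.subst, ih]

theorem _root_.FirstOrder.Language.Term.subst_relabel {α β γ : Type*} (t : L.Term α)
    (σ : α → L.Term β) (g : β → γ) : (t.subst σ).relabel g = t.subst fun i => (σ i).relabel g := by
  simp only [Term.relabel_eq_subst, Term.subst_subst]

theorem _root_.FirstOrder.Language.Term.relabel_subst {α β γ : Type*} (t : L.Term α)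
    (g : α → β) (τ : β → L.Term γ) : (t.relabel g).subst τ = t.subst fun i => τ (g i) := by
  simp only [Term.relabel_eq_subst, Term.subst_subst]; rfl

theorem _root_.FirstOrder.Language.Term.exists_support (t : L.Term ℕ) :
    ∃ N, ∀ σ τ : ℕ → L.Term ℕ, (∀ i < N, σ i = τ i) → t.subst σ = t.subst τ := by
  induction t with
  | var n => exact ⟨n + 1, fun σ τ h => h n n.lt_succ_self⟩
  | func f ts ih =>
    choose N hN using ih
    refine ⟨Finset.univ.sup N, fun σ τ h => ?_⟩
    simp only [Term.subst]
    congr 1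
    funext i
    exact hN i σ τ fun j hj => h j (hj.trans_le (Finset.le_sup (Finset.mem_univ i)))

namespace Fml

theorem upSubst_var : upSubst (L := L) Term.var = Term.var := by
  funext i; cases i <;> rfl

theorem upSubst_subst_upSubst (σ τ : ℕ → L.Term ℕ) (i : ℕ) :
    (upSubst σ i).subst (upSubst τ) = upSubst (fun j => (σ j).subst τ) i := by
  cases i with
  | zero => rfl
  | succ i => simp only [upSubst, consVal, Term.relabel_subst, Term.subst_relabel]

theorem subst_subst (φ : Fml Θ) (σ τ : ℕ → L.Term ℕ) :
    (φ.subst σ).subst τ = φ.subst fun i => (σ i).subst τ := by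
  induction φ generalizing σ τ with
  | all φ ih => simp only [subst, ih, upSubst_subst_upSubst]
  | _ => simp_all [subst, Term.subst_subst]

theorem subst_var (φ : Fml Θ) : φ.subst Term.var = φ := by
  induction φ with
  | all φ ih => simp only [subst, upSubst_var, ih]
  | _ => simp_all [subst, Term.subst_var]

theorem upSubst_inst (σ : ℕ → L.Term ℕ) (t : L.Term ℕ) :
    (fun i => (upSubst σ i).subst (consVal t Term.var)) = consVal t σ := by
  funext i
  cases i with
  | zero => rfl
  | succ i =>
    simp only [upSubst, consVal, Term.relabel_subst]
    exact Term.subst_var _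

theorem inst_subst_upSubst (φ : Fml Θ) (σ : ℕ → L.Term ℕ) (t : L.Term ℕ) :
    (φ.subst (upSubst σ)).inst t = φ.subst (consVal t σ) := by
  rw [inst, subst_subst, upSubst_inst]

/-- Only finitely many variables occur, so all indices from `N` on are fresh. Freshness is phrased
through substitutions because it serves to rename a fresh variable away. -/
theorem exists_support (φ : Fml Θ) :
    ∃ N, ∀ σ τ : ℕ → L.Term ℕ, (∀ i < N, σ i = τ i) → φ.subst σ = φ.subst τ := by
  induction φ with
  | equal t s =>
    obtain ⟨N, hN⟩ := t.exists_support
    obtain ⟨M, hM⟩ := s.exists_support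
    exact ⟨max N M, fun σ τ h => by
      simp only [subst, hN σ τ fun i hi => h i (lt_max_of_lt_left hi),
        hM σ τ fun i hi => h i (lt_max_of_lt_right hi)]⟩
  | rel R ts =>
    choose N hN using fun i => (ts i).exists_support
    refine ⟨Finset.univ.sup N, fun σ τ h => ?_⟩
    simp only [subst]
    congr 1
    funext i
    exact hN i σ τ fun j hj => h j (hj.trans_le (Finset.le_sup (Finset.mem_univ i)))
  | rvar l m ts =>
    choose N hN using fun i => (ts i).exists_support
    refine ⟨Finset.univ.sup N, fun σ τ h => ?_⟩
    simp only [subst]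
    congr 1
    funext i
    exact hN i σ τ fun j hj => h j (hj.trans_le (Finset.le_sup (Finset.mem_univ i)))
  | req l i j => exact ⟨0, fun _ _ _ => rfl⟩
  | neg φ ih =>
    obtain ⟨N, hN⟩ := ih
    exact ⟨N, fun σ τ h => by simp only [subst, hN σ τ h]⟩
  | and φ ψ ih ih' =>
    obtain ⟨N, hN⟩ := ih
    obtain ⟨M, hM⟩ := ih'
    exact ⟨max N M, fun σ τ h => by
      simp only [subst, hN σ τ fun i hi => h i (lt_max_of_lt_left hi),
        hM σ τ fun i hi => h i (lt_max_of_lt_right hi)]⟩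
  | all φ ih =>
    obtain ⟨N, hN⟩ := ih
    -- The bound of the body still works: agreement of the lifted substitutions at `i + 1 < N` only
    -- asks for agreement at `i`.
    refine ⟨N, fun σ τ h => ?_⟩
    rw [subst, subst, hN (upSubst σ) (upSubst τ)]
    rintro (_ | i) hi
    · rfl
    · simp only [upSubst, consVal, h i (by omega)]
  | allR l φ ih =>
    obtain ⟨N, hN⟩ := ih
    exact ⟨N, fun σ τ h => by simp only [subst, hN σ τ h]⟩

theorem upSubst_iterate_lt (n : ℕ) (σ : ℕ → L.Term ℕ) (i : ℕ) (h : i < n) :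
    upSubst^[n] σ i = Term.var i := by
  induction n generalizing i with
  | zero => omega
  | succ n ih =>
    rw [Function.iterate_succ_apply']
    cases i with
    | zero => rfl
    | succ i => simp only [upSubst, consVal, ih i (by omega), Term.relabel]

theorem upSubst_iterate_add (n : ℕ) (σ : ℕ → L.Term ℕ) (i : ℕ) :
    upSubst^[n] σ (i + n) = (σ i).relabel (· + n) := by
  induction n with
  | zero => exact (Term.relabel_id _).symm
  | succ n ih =>
    rw [Function.iterate_succ_apply', ← add_assoc]
    simp only [upSubst, consVal, ih, Term.relabel_relabel]
    rfl

theorem subst_allN (n : ℕ) (φ : Fml Θ) (σ : ℕ → L.Term ℕ) :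
    (allN n φ).subst σ = allN n (φ.subst (upSubst^[n] σ)) := by
  induction n generalizing σ with
  | zero => rfl
  | succ n ih => simp only [allN, subst, ih, Function.iterate_succ_apply]

theorem subst_imp (φ ψ : Fml Θ) (σ : ℕ → L.Term ℕ) :
    (φ.imp ψ).subst σ = (φ.subst σ).imp (ψ.subst σ) := rfl

theorem subst_iff (φ ψ : Fml Θ) (σ : ℕ → L.Term ℕ) :
    (φ.iff ψ).subst σ = (φ.subst σ).iff (ψ.subst σ) := rfl

theorem substR_imp (φ ψ : Fml Θ) (τ : ∀ k : RelSort Θ, ℕ → RelExpr Θ k) :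
    (φ.imp ψ).substR τ = (φ.substR τ).imp (ψ.substR τ) := rfl

theorem substR_iff (φ ψ : Fml Θ) (τ : ∀ k : RelSort Θ, ℕ → RelExpr Θ k) :
    (φ.iff ψ).substR τ = (φ.substR τ).iff (ψ.substR τ) := rfl

theorem subst_ofFirstOrder {α : Type} {n : ℕ} (χ : L.BoundedFormula α n) (a : α → L.Term ℕ)
    (b : Fin n → L.Term ℕ) (σ : ℕ → L.Term ℕ) :
    (ofFirstOrder χ a b : Fml Θ).subst σ =
      ofFirstOrder χ (fun i => (a i).subst σ) (fun i => (b i).subst σ) := by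
  have hs : ∀ {n : ℕ} (b : Fin n → L.Term ℕ) (t : L.Term (α ⊕ Fin n)) (σ : ℕ → L.Term ℕ)
      (a : α → L.Term ℕ), (t.subst (Sum.elim a b)).subst σ =
        t.subst (Sum.elim (fun i => (a i).subst σ) (fun i => (b i).subst σ)) := by
    intro n b t σ a
    rw [Term.subst_subst]
    congr 1
    funext i
    cases i <;> rfl
  induction χ generalizing a σ with
  | falsum => rfl
  | equal t s => simp only [ofFirstOrder, subst, hs]
  | rel R ts => simp only [ofFirstOrder, subst, hs]
  | imp χ ξ ih ih' => simp only [ofFirstOrder, subst_imp, ih, ih']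
  | @all n χ ih =>
    simp only [ofFirstOrder, subst, ih]
    congr 2
    · funext i
      simp only [Term.relabel_subst, Term.subst_relabel, upSubst, consVal]
    · funext i
      refine Fin.lastCases ?_ (fun i => ?_) i
      · simp only [Fin.snoc_last]; rfl
      · simp only [Fin.snoc_castSucc, Term.relabel_subst, Term.subst_relabel, upSubst, consVal]

/-- First-order formulas contain no relation variables, so a `θ(·, z̄)` that has been substituted is
left alone by later substitutions of this kind. -/
theorem substR_ofFirstOrder {α : Type} {n : ℕ} (χ : L.BoundedFormula α n) (a : α → L.Term ℕ)
    (b : Fin n → L.Term ℕ) (τ : ∀ k : RelSort Θ, ℕ → RelExpr Θ k) :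
    (ofFirstOrder χ a b : Fml Θ).substR τ = ofFirstOrder χ a b := by
  induction χ generalizing a τ with
  | imp χ ξ ih ih' => simp only [ofFirstOrder, substR_imp, ih, ih']
  | all χ ih => simp only [ofFirstOrder, substR, ih]
  | _ => rfl

end Fml

theorem DefFormula.subst_app {l : ℕ} (θ : DefFormula L l) (ts : Fin (l + 1) → L.Term ℕ)
    (e : Fin θ.params → L.Term ℕ) (σ : ℕ → L.Term ℕ) :
    (θ.app ts e : Fml Θ).subst σ = θ.app (fun i => (ts i).subst σ) (fun i => (e i).subst σ) := by
  rw [DefFormula.app, Fml.subst_ofFirstOrder, DefFormula.app]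
  congr 1
  · funext i
    cases i <;> rfl
  · exact Subsingleton.elim _ _

theorem DefFormula.substR_app {l : ℕ} (θ : DefFormula L l) (ts : Fin (l + 1) → L.Term ℕ)
    (e : Fin θ.params → L.Term ℕ) (τ : ∀ k : RelSort Θ, ℕ → RelExpr Θ k) :
    (θ.app ts e : Fml Θ).substR τ = θ.app ts e := Fml.substR_ofFirstOrder _ _ _ _

namespace RelExpr

variable {l : RelSort Θ}

/-- Substitution of terms for the first-order variables of a relation expression. -/
def subst (σ : ℕ → L.Term ℕ) : RelExpr Θ l → RelExpr Θ l
  | var i => var i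
  | defn θ e => defn θ fun j => (e j).subst σ

theorem subst_app (E : RelExpr Θ l) (ts : Fin (l.1 + 1) → L.Term ℕ) (σ : ℕ → L.Term ℕ) :
    (E.app ts).subst σ = (E.subst σ).app fun i => (ts i).subst σ := by
  cases E with
  | var => rfl
  | defn θ e => exact θ.subst_app ts e σ

theorem shift_subst_upSubst (E : RelExpr Θ l) (n : ℕ) (σ : ℕ → L.Term ℕ) :
    (E.shift n).subst (Fml.upSubst^[n] σ) = (E.subst σ).shift n := by
  cases E with
  | var => rfl
  | defn θ e =>
    simp only [shift, subst, Term.relabel_subst, Fml.upSubst_iterate_add, Term.subst_relabel]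

theorem shiftR_subst (E : RelExpr Θ l) (σ : ℕ → L.Term ℕ) :
    E.shiftR.subst σ = (E.subst σ).shiftR := by
  cases E <;> rfl

theorem shift_zero (E : RelExpr Θ l) : E.shift 0 = E := by
  cases E with
  | var => rfl
  | defn θ e =>
    simp only [shift]
    congr 1
    funext j
    exact Term.relabel_id _

theorem shift_shift (E : RelExpr Θ l) (m n : ℕ) : (E.shift m).shift n = E.shift (m + n) := by
  cases E with
  | var => rfl
  | defn θ e =>
    simp only [shift, Term.relabel_relabel]
    congr 1
    funext j
    congr 1
    funext i
    simp only [Function.comp_apply]; omega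

theorem subst_coext (E E' : RelExpr Θ l) (σ : ℕ → L.Term ℕ) :
    (coext E E').subst σ = coext (E.subst σ) (E'.subst σ) := by
  have h : (fun j : Fin (l.1 + 1) => (Term.var (L := L) j.1).subst (Fml.upSubst^[l.1 + 1] σ)) =
      fun j => Term.var j.1 := by
    funext j
    exact Fml.upSubst_iterate_lt _ _ _ j.2
  simp only [coext, Fml.subst_allN, Fml.subst_iff, subst_app, shift_subst_upSubst, h]

theorem subst_eq (E E' : RelExpr Θ l) (σ : ℕ → L.Term ℕ) :
    (E.eq E').subst σ = (E.subst σ).eq (E'.subst σ) := by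
  cases E <;> cases E' <;> first | rfl | exact subst_coext _ _ _

end RelExpr

/-- Substitution of terms in the values of a substitution for relation variables. -/
def substRelSubst (τ : ∀ k : RelSort Θ, ℕ → RelExpr Θ k) (σ : ℕ → L.Term ℕ) :
    ∀ k : RelSort Θ, ℕ → RelExpr Θ k := fun k i => (τ k i).subst σ

theorem substRelSubst_upSubstR (l : RelSort Θ) (τ : ∀ k : RelSort Θ, ℕ → RelExpr Θ k)
    (σ : ℕ → L.Term ℕ) :
    substRelSubst (upSubstR l τ) σ = upSubstR l (substRelSubst τ σ) := by
  funext k i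
  by_cases h : k = l
  · subst h
    cases i with
    | zero => simp [substRelSubst, upSubstR, consVal, RelExpr.subst]
    | succ i => simp [substRelSubst, upSubstR, consVal, RelExpr.shiftR_subst]
  · simp [substRelSubst, upSubstR, h]

theorem substRelSubst_instSubstR (l : RelSort Θ) (E : RelExpr Θ l) (σ : ℕ → L.Term ℕ) :
    substRelSubst (instSubstR l E) σ = instSubstR l (E.subst σ) := by
  funext k i
  by_cases h : k = l
  · subst h
    cases i with
    | zero => simp [substRelSubst, instSubstR, consVal]
    | succ i => simp [substRelSubst, instSubstR, consVal, RelExpr.subst]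
  · simp [substRelSubst, instSubstR, h, RelExpr.subst]

namespace Fml

/-- The two kinds of substitution commute once `σ` is also applied to the parameters `ē` of the
expressions `θ(·, ē)`; their shift under `all` matches `upSubst`. -/
theorem substR_subst (φ : Fml Θ) (τ : ∀ k : RelSort Θ, ℕ → RelExpr Θ k) (σ : ℕ → L.Term ℕ) :
    (φ.substR τ).subst σ = (φ.subst σ).substR (substRelSubst τ σ) := by
  induction φ generalizing τ σ with
  | equal => rfl
  | rel => rfl
  | rvar l i ts => exact RelExpr.subst_app _ _ _
  | req l i j => exact RelExpr.subst_eq _ _ _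
  | neg φ ih => simp only [substR, subst, ih]
  | and φ ψ ih ih' => simp only [substR, subst, ih, ih']
  | all φ ih =>
    simp only [substR, subst, ih]
    congr 2
    funext k i
    exact RelExpr.shift_subst_upSubst _ 1 _
  | allR l φ ih => simp only [substR, subst, ih, substRelSubst_upSubstR]

theorem instR_subst (l : RelSort Θ) (E : RelExpr Θ l) (φ : Fml Θ) (σ : ℕ → L.Term ℕ) :
    (φ.instR l E).subst σ = (φ.subst σ).instR l (E.subst σ) := by
  rw [instR, substR_subst, substRelSubst_instSubstR, instR]

theorem substR_allN (n : ℕ) (φ : Fml Θ) (τ : ∀ k : RelSort Θ, ℕ → RelExpr Θ k) :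
    (allN n φ).substR τ = allN n (φ.substR fun k i => (τ k i).shift n) := by
  induction n generalizing τ with
  | zero => simp only [allN, RelExpr.shift_zero]
  | succ n ih => simp only [allN, substR, ih, RelExpr.shift_shift, Nat.add_comm 1]

/-- Renaming of the free relation variables. -/
def renR (ρ : RelSort Θ → ℕ → ℕ) (φ : Fml Θ) : Fml Θ := φ.substR fun k i => .var (ρ k i)

/-- The renaming `ρ` moved under the quantifier `allR l`. -/
def upRen (l : RelSort Θ) (ρ : RelSort Θ → ℕ → ℕ) : RelSort Θ → ℕ → ℕ :=
  Function.update ρ l (consVal 0 fun i => ρ l i + 1)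

theorem upSubstR_upRen (l : RelSort Θ) (ρ : RelSort Θ → ℕ → ℕ)
    (τ : ∀ k : RelSort Θ, ℕ → RelExpr Θ k) :
    (fun k i => upSubstR l τ k (upRen l ρ k i)) = upSubstR l fun k i => τ k (ρ k i) := by
  funext k i
  by_cases h : k = l
  · subst h
    cases i <;> simp [upSubstR, upRen, consVal]
  · simp [upSubstR, upRen, h]

theorem upSubstR_var (l : RelSort Θ) (ρ : RelSort Θ → ℕ → ℕ) :
    (upSubstR l fun k i => .var (ρ k i)) = fun k i => .var (upRen l ρ k i) := by
  funext k i
  by_cases h : k = l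
  · subst h
    cases i <;> simp [upSubstR, upRen, consVal, RelExpr.shiftR]
  · simp [upSubstR, upRen, h]

theorem renR_allR (l : RelSort Θ) (ρ : RelSort Θ → ℕ → ℕ) (φ : Fml Θ) :
    (allR l φ).renR ρ = allR l (φ.renR (upRen l ρ)) := by
  rw [renR, substR, upSubstR_var, renR]

theorem renR_all (ρ : RelSort Θ → ℕ → ℕ) (φ : Fml Θ) : (all φ).renR ρ = all (φ.renR ρ) := rfl

theorem renR_allN (n : ℕ) (ρ : RelSort Θ → ℕ → ℕ) (φ : Fml Θ) :
    (allN n φ).renR ρ = allN n (φ.renR ρ) := substR_allN _ _ _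

theorem renR_substR (φ : Fml Θ) (ρ : RelSort Θ → ℕ → ℕ)
    (τ : ∀ k : RelSort Θ, ℕ → RelExpr Θ k) :
    (φ.renR ρ).substR τ = φ.substR fun k i => τ k (ρ k i) := by
  induction φ generalizing ρ τ with
  | equal => rfl
  | rel => rfl
  | rvar l i ts => rfl
  | req l i j => rfl
  | neg φ ih => exact congrArg neg (ih _ _)
  | and φ ψ ih ih' => exact congrArg₂ and (ih _ _) (ih' _ _)
  | all φ ih => exact congrArg all (ih _ _)
  | allR l φ ih => rw [renR_allR, substR, ih, upSubstR_upRen, substR]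

theorem renR_subst (φ : Fml Θ) (ρ : RelSort Θ → ℕ → ℕ) (σ : ℕ → L.Term ℕ) :
    (φ.renR ρ).subst σ = (φ.subst σ).renR ρ := substR_subst _ _ _

theorem renR_id (φ : Fml Θ) : φ.renR (fun _ i => i) = φ := by
  have hu : ∀ l : RelSort Θ, upRen l (fun _ i => i) = fun _ i => i := by
    intro l
    funext k i
    by_cases h : k = l
    · subst h
      cases i <;> simp [upRen, consVal]
    · simp [upRen, h]
  induction φ with
  | equal => rfl
  | rel => rfl
  | rvar l i ts => rfl
  | req l i j => rfl
  | neg φ ih => exact congrArg neg ih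
  | and φ ψ ih ih' => exact congrArg₂ and ih ih'
  | all φ ih => exact congrArg all ih
  | allR l φ ih => rw [renR_allR, hu, ih]

/-- The renaming which sends the relation variable `0` of sort `l` to `j` and moves the other
variables of this sort down. -/
def instRen (l : RelSort Θ) (j : ℕ) (ρ : RelSort Θ → ℕ → ℕ) : RelSort Θ → ℕ → ℕ :=
  Function.update ρ l (consVal j (ρ l))

theorem instR_var_eq_renR (l : RelSort Θ) (j : ℕ) (φ : Fml Θ) :
    φ.instR l (.var j) = φ.renR (instRen l j fun _ i => i) := by
  rw [instR, renR]
  congr 1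
  funext k i
  by_cases h : k = l
  · subst h
    cases i <;> simp [instSubstR, instRen, consVal]
  · simp [instSubstR, instRen, h]

theorem renR_renR (φ : Fml Θ) (ρ ρ' : RelSort Θ → ℕ → ℕ) :
    (φ.renR ρ).renR ρ' = φ.renR fun k i => ρ' k (ρ k i) := renR_substR _ _ _

theorem instR_renR_upRen (l : RelSort Θ) (j : ℕ) (φ : Fml Θ) (ρ : RelSort Θ → ℕ → ℕ) :
    (φ.renR (upRen l ρ)).instR l (.var j) = φ.renR (instRen l j ρ) := by
  rw [instR_var_eq_renR, renR_renR]
  congr 1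
  funext k i
  by_cases h : k = l
  · subst h
    cases i <;> simp [upRen, instRen, consVal]
  · simp [upRen, instRen, h]

theorem shiftR_eq_renR (l : RelSort Θ) (φ : Fml Θ) :
    φ.shiftR l = φ.renR (Function.update (fun _ i => i) l fun i => i + 1) := by
  rw [shiftR, renR]
  congr 1
  funext k i
  by_cases h : k = l
  · subst h; simp
  · simp [h]

theorem exists_supportR (φ : Fml Θ) :
    ∃ N, ∀ ρ ρ' : RelSort Θ → ℕ → ℕ, (∀ k, ∀ i < N, ρ k i = ρ' k i) →
      φ.renR ρ = φ.renR ρ' := by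
  induction φ with
  | equal => exact ⟨0, fun _ _ _ => rfl⟩
  | rel => exact ⟨0, fun _ _ _ => rfl⟩
  | rvar l i ts =>
    exact ⟨i + 1, fun ρ ρ' h => by simp only [renR, substR, h l i i.lt_succ_self]⟩
  | req l i j =>
    exact ⟨max i j + 1, fun ρ ρ' h => by
      simp only [renR, substR, h l i (by omega), h l j (by omega)]⟩
  | neg φ ih =>
    obtain ⟨N, hN⟩ := ih
    exact ⟨N, fun ρ ρ' h => congrArg neg (hN ρ ρ' h)⟩
  | and φ ψ ih ih' =>
    obtain ⟨N, hN⟩ := ih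
    obtain ⟨M, hM⟩ := ih'
    exact ⟨max N M, fun ρ ρ' h => congrArg₂ and
      (hN ρ ρ' fun k i hi => h k i (lt_max_of_lt_left hi))
      (hM ρ ρ' fun k i hi => h k i (lt_max_of_lt_right hi))⟩
  | all φ ih =>
    obtain ⟨N, hN⟩ := ih
    exact ⟨N, fun ρ ρ' h => congrArg all (hN ρ ρ' h)⟩
  | allR l φ ih =>
    obtain ⟨N, hN⟩ := ih
    refine ⟨N, fun ρ ρ' h => ?_⟩
    rw [renR_allR, renR_allR, hN (upRen l ρ) (upRen l ρ')]
    intro k i hi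
    by_cases hk : k = l
    · subst hk
      cases i with
      | zero => simp [upRen, consVal]
      | succ i => simp [upRen, consVal, h k i (by omega)]
    · simp [upRen, hk, h k i hi]

end Fml

end Substitution

end RestrictedSO

namespace RestrictedSO

/-! ### Derived rules, and the meets and joins in the Lindenbaum algebra. -/

section Derivations

variable {L : FirstOrder.Language.{u, v}} {Θ : DefClass L} {Γ : Set (Fml Θ)}

open Fml

theorem Provable.imp_trans {φ ψ χ : Fml Θ} (h : Provable Γ (φ.imp ψ))
    (h' : Provable Γ (ψ.imp χ)) : Provable Γ (φ.imp χ) :=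
  .of_taut₂ h h' fun v hn ha => by simp only [Fml.imp, hn, ha]; tauto

theorem Provable.imp_refl (φ : Fml Θ) : Provable Γ (φ.imp φ) :=
  .of_taut fun v hn ha => by simp only [Fml.imp, hn, ha]; tauto

/-- The substitution of `a` for the first `n` variables, followed by `σ`. -/
def preSubst {X : Type w} (n : ℕ) (a : Fin n → X) (σ : ℕ → X) : ℕ → X :=
  fun i => if h : i < n then a ⟨i, h⟩ else σ (i - n)

theorem preSubst_val {X : Type w} (n : ℕ) (a : Fin n → X) (σ : ℕ → X) (i : Fin n) :
    preSubst n a σ i.1 = a i := by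
  simp [preSubst]

theorem preSubst_add {X : Type w} (n : ℕ) (a : Fin n → X) (σ : ℕ → X) (i : ℕ) :
    preSubst n a σ (i + n) = σ i := by
  simp [preSubst]

/-- The outermost of `n + 1` quantifiers binds the variable `n`, so the last entry of `a` is
instantiated first and becomes the head of the tail. -/
theorem preSubst_snoc {X : Type w} (n : ℕ) (a : Fin (n + 1) → X) (σ : ℕ → X) :
    preSubst n (fun i => a i.castSucc) (consVal (a (Fin.last n)) σ) = preSubst (n + 1) a σ := by
  funext i
  rcases lt_trichotomy i n with h | h | h
  · simp [preSubst, h, h.trans n.lt_succ_self]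
  · subst h
    simp [preSubst, consVal, Fin.last]
  · obtain ⟨k, rfl⟩ := Nat.exists_eq_add_of_lt h
    have h1 : ¬ n + k + 1 < n := by omega
    have h2 : ¬ n + k + 1 < n + 1 := by omega
    have h3 : n + k + 1 - n = k + 1 := by omega
    have h4 : n + k + 1 - (n + 1) = k := by omega
    simp only [preSubst, h1, h2, h3, h4, dif_neg, not_false_eq_true, consVal]

/-- Quantifiers are removed from outside inwards; `σ` is arbitrary because each instantiation leaves
a substituted matrix. -/
theorem provable_allN_subst_imp (n : ℕ) (φ : Fml Θ) (a : Fin n → L.Term ℕ) (σ : ℕ → L.Term ℕ) :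
    Provable Γ (((allN n φ).subst σ).imp (φ.subst (preSubst n a σ))) := by
  induction n generalizing σ with
  | zero => exact .imp_refl _
  | succ n ih =>
    refine .imp_trans (.ax (.allInst _ (a (Fin.last n)))) ?_
    rw [inst_subst_upSubst, ← preSubst_snoc]
    exact ih _ _

theorem Provable.genN {φ : Fml Θ} (h : Provable Γ φ) : ∀ n, Provable Γ (allN n φ)
  | 0 => h
  | n + 1 => .gen (h.genN n)

/-- Generalize over the finitely many variables that matter, then instantiate them all by the values
of `σ`. -/
theorem Provable.subst {φ : Fml Θ} (h : Provable Γ φ) (σ : ℕ → L.Term ℕ) :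
    Provable Γ (φ.subst σ) := by
  obtain ⟨N, hN⟩ := φ.exists_support
  have := Provable.mp (provable_allN_subst_imp N φ (fun i => σ i.1) Term.var)
    (by rw [Fml.subst_var]; exact h.genN N)
  rwa [hN _ σ fun i hi => preSubst_val N _ _ ⟨i, hi⟩] at this

theorem provable_allR_iterate_imp (l : RelSort Θ) (n : ℕ) (φ : Fml Θ) (a : Fin n → ℕ)
    (ρ : RelSort Θ → ℕ → ℕ) :
    Provable Γ ((((allR l)^[n] φ).renR ρ).imp
      (φ.renR (Function.update ρ l (preSubst n a (ρ l))))) := by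
  induction n generalizing ρ with
  | zero =>
    have : Function.update ρ l (preSubst 0 a (ρ l)) = ρ := Function.update_eq_self _ _
    rw [this]
    exact .imp_refl _
  | succ n ih =>
    rw [Function.iterate_succ_apply', renR_allR]
    refine .imp_trans (.ax (.allRInst _ _ (a (Fin.last n)))) ?_
    rw [instR_renR_upRen, ← preSubst_snoc]
    have := ih (fun i => a i.castSucc) (instRen l (a (Fin.last n)) ρ)
    simpa only [instRen, Function.update_self, Function.update_idem] using this

theorem Provable.genR_iterate (l : RelSort Θ) {φ : Fml Θ} (h : Provable Γ φ) (n : ℕ) :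
    Provable Γ ((allR l)^[n] φ) := by
  induction n with
  | zero => exact h
  | succ n ih => rw [Function.iterate_succ_apply']; exact .genR l ih

theorem Provable.renR (l : RelSort Θ) {φ : Fml Θ} (h : Provable Γ φ) (f : ℕ → ℕ) :
    Provable Γ (φ.renR (Function.update (fun _ i => i) l f)) := by
  obtain ⟨N, hN⟩ := φ.exists_supportR
  have := Provable.mp (provable_allR_iterate_imp l N φ (fun i => f i.1) fun _ i => i)
    (by rw [renR_id]; exact h.genR_iterate l N)
  rwa [hN _ (Function.update (fun _ i => i) l f)] at this
  intro k i hi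
  by_cases hk : k = l
  · subst hk
    simpa using preSubst_val N _ _ ⟨i, hi⟩
  · simp [hk]

theorem provable_imp_all_of_fresh {χ ψ : Fml Θ}
    (h : ∀ m, Provable Γ (χ.imp (ψ.inst (Term.var m)))) : Provable Γ (χ.imp (all ψ)) := by
  obtain ⟨N, hN⟩ := χ.exists_support
  obtain ⟨M, hM⟩ := ψ.exists_support
  refine .mp (.ax (.allImp _ _)) (.gen ?_)
  -- The index `max N M` is fresh for both formulas. Sending it to `0` and every other `i` to `i +
  -- 1` turns the instance back into `ψ`, and `χ` into `χ.shift 1`, as `allImp` requires.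
  have := (h (max N M)).subst fun i => if i = max N M then Term.var 0 else Term.var (i + 1)
  rw [subst_imp, inst, subst_subst] at this
  rw [shift]
  convert this using 2
  · exact hN _ _ fun i hi => by rw [if_neg (by omega)]
  · conv_lhs => rw [← ψ.subst_var]
    refine hM _ _ fun i hi => ?_
    cases i with
    | zero => simp [consVal, Term.subst]
    | succ i => simp only [consVal, Term.subst]; rw [if_neg (by omega)]

theorem provable_imp_allR_of_fresh (l : RelSort Θ) {χ ψ : Fml Θ}
    (h : ∀ m, Provable Γ (χ.imp (ψ.instR l (.var m)))) : Provable Γ (χ.imp (allR l ψ)) := by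
  obtain ⟨N, hN⟩ := χ.exists_supportR
  obtain ⟨M, hM⟩ := ψ.exists_supportR
  refine .mp (.ax (.allRImp _ _ _)) (.genR l ?_)
  have := (h (max N M)).renR l fun i => if i = max N M then 0 else i + 1
  rw [Fml.renR, substR_imp, ← Fml.renR, ← Fml.renR, instR_var_eq_renR, renR_renR] at this
  rw [shiftR_eq_renR]
  convert this using 2
  · refine hN _ _ fun k i hi => ?_
    by_cases hk : k = l
    · subst hk
      simp only [Function.update_self]
      rw [if_neg (by omega)]
    · simp [hk]
  · conv_lhs => rw [← ψ.renR_id]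
    refine hM _ _ fun k i hi => ?_
    by_cases hk : k = l
    · subst hk
      cases i with
      | zero => simp [instRen, consVal]
      | succ i => simp only [instRen, consVal, Function.update_self]; rw [if_neg (by omega)]
    · simp [instRen, hk]

theorem provable_imp_allN {n : ℕ} {χ ψ : Fml Θ} (h : Provable Γ ((χ.shift n).imp ψ)) :
    Provable Γ (χ.imp (allN n ψ)) := by
  induction n generalizing χ with
  | zero =>
    have : χ.shift 0 = χ := χ.subst_var
    rwa [this] at h
  | succ n ih =>
    refine .mp (.ax (.allImp _ _)) (.gen (ih ?_))
    have : (χ.shift 1).shift n = χ.shift (n + 1) := by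
      simp only [shift, subst_subst, Term.subst, add_assoc, Nat.add_comm 1]
    rwa [this]

/-- Here the infinitary rule enters. Its premise for `θ` quantifies the parameters universally, and
one instance at fresh parameter variables suffices to derive it. -/
theorem provable_imp_allR_of_fresh_defn (l : RelSort Θ) {χ ψ : Fml Θ}
    (h : ∀ θ ∈ Θ l.1, ∀ z : Fin θ.params → ℕ,
      Provable Γ (χ.imp (ψ.instR l (.defn θ fun j => Term.var (z j))))) :
    Provable Γ (χ.imp (allR l ψ)) := by
  refine .omegaRule l fun θ hθ => provable_imp_allN ?_
  obtain ⟨N, hN⟩ := χ.exists_support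
  obtain ⟨M, hM⟩ := ψ.exists_support
  -- The fresh parameters become the variables `x_j` that are to be quantified; the old variables
  -- make room by moving up by `θ.params`.
  have := (h θ hθ fun j => max N M + j.1).subst fun i =>
    if i < max N M then Term.var (i + θ.params) else Term.var (i - max N M)
  rw [subst_imp, instR_subst] at this
  convert this using 2
  · exact hN _ _ fun i hi => by rw [if_pos (by omega)]
  · congr 1
    · simp only [RelExpr.subst, Term.subst]
      congr 1
      funext j
      rw [if_neg (by omega), Nat.add_sub_cancel_left]
    · exact hM _ _ fun i hi => by rw [if_pos (by omega)]

theorem provable_repl_imp (l : RelSort Θ) (θ : DefFormula L l.1) (ψ : Fml Θ)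
    (e : Fin θ.params → L.Term ℕ) :
    Provable Γ ((ψ.repl l θ).imp (ψ.instR l (.defn θ e))) := by
  have := provable_allN_subst_imp (Γ := Γ) θ.params
    ((ψ.shift θ.params).instR l (.defn θ fun j => Term.var j.1)) e Term.var
  rw [Fml.subst_var, instR_subst, shift, subst_subst] at this
  convert this using 2
  · rfl
  · simp only [RelExpr.subst, Term.subst, preSubst_val, preSubst_add]
    exact congrArg (instR l _) ψ.subst_var.symm

-- A `χ` that lies below all instances lies below the one at a fresh variable, to which
-- generalization applies.
variable (Γ) in
theorem isGLB_inst (ψ : Fml Θ) :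
    IsGLB {a | ∃ m : ℕ, a = cls Γ (ψ.inst (Term.var m))} (cls Γ (all ψ)) := by
  constructor
  · rintro _ ⟨m, rfl⟩
    exact .ax (.allInst _ _)
  · rintro ⟨χ⟩ h
    exact provable_imp_all_of_fresh fun m => h ⟨m, rfl⟩

variable (Γ) in
theorem isGLB_instR_var (l : RelSort Θ) (ψ : Fml Θ) :
    IsGLB {a | ∃ m : ℕ, a = cls Γ (ψ.instR l (.var m))} (cls Γ (allR l ψ)) := by
  constructor
  · rintro _ ⟨m, rfl⟩
    exact .ax (.allRInst _ _ _)
  · rintro ⟨χ⟩ h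
    exact provable_imp_allR_of_fresh l fun m => h ⟨m, rfl⟩

-- The element of `isGLB_instR_var` is also the meet of this quite different set: `allRRepl` makes
-- it a lower bound, `omegaRule` the greatest one.
variable (Γ) in
theorem isGLB_instR_defn (l : RelSort Θ) (ψ : Fml Θ) :
    IsGLB {a | ∃ θ ∈ Θ l.1, ∃ z : Fin θ.params → ℕ,
      a = cls Γ (ψ.instR l (.defn θ fun j => Term.var (z j)))} (cls Γ (allR l ψ)) := by
  constructor
  · rintro _ ⟨θ, hθ, z, rfl⟩
    exact .imp_trans (.ax (.allRRepl _ _ _ hθ)) (provable_repl_imp _ _ _ _)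
  · rintro ⟨χ⟩ h
    exact provable_imp_allR_of_fresh_defn l fun θ hθ z => h ⟨θ, hθ, z, rfl⟩

theorem isLUB_of_isGLB_compl {B : Type w} [BooleanAlgebra B] {S : Set B} {a : B}
    (h : IsGLB {b | bᶜ ∈ S} a) : IsLUB S aᶜ := by
  constructor
  · intro b hb
    exact le_compl_comm.1 (h.1 (by simpa using hb))
  · intro c hc
    exact compl_le_iff_compl_le.1 (h.2 fun b hb => compl_le_iff_compl_le.1 (hc hb))

theorem cls_neg (φ : Fml Θ) : cls Γ (neg φ) = (cls Γ φ)ᶜ := rfl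

theorem compl_preimage_instances {ι : Sort*} (f : ι → Fml Θ) :
    {b : Lindenbaum Γ | bᶜ ∈ {a | ∃ i, a = cls Γ (f i)}} = {a | ∃ i, a = cls Γ (neg (f i))} := by
  ext b
  simp only [Set.mem_ofPred_eq, cls_neg]
  exact exists_congr fun i => compl_eq_comm.trans eq_comm

-- The joins follow by De Morgan from the meets for `neg ψ`, since instantiation commutes with
-- `neg`.
variable (Γ) in
theorem isRegularFamily_instFamily : IsRegularFamily (instFamily Γ) := by
  rintro S ((⟨ψ, rfl⟩ | ⟨l, ψ, rfl⟩) | ⟨l, ψ, rfl⟩)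
  · refine ⟨⟨_, isLUB_of_isGLB_compl (a := cls Γ (all (neg ψ))) ?_⟩, _, isGLB_inst Γ ψ⟩
    rw [compl_preimage_instances]
    exact isGLB_inst Γ (neg ψ)
  · refine ⟨⟨_, isLUB_of_isGLB_compl (a := cls Γ (allR l (neg ψ))) ?_⟩, _,
      isGLB_instR_var Γ l ψ⟩
    rw [compl_preimage_instances]
    exact isGLB_instR_var Γ l (neg ψ)
  · refine ⟨⟨_, isLUB_of_isGLB_compl (a := cls Γ (allR l (neg ψ))) ?_⟩, _,
      isGLB_instR_defn Γ l ψ⟩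
    refine (congrArg (IsGLB · _) (Set.ext fun b => ?_)).mpr (isGLB_instR_defn Γ l (neg ψ))
    refine exists_congr fun θ => and_congr_right fun _ => exists_congr fun z => ?_
    exact compl_eq_comm.trans eq_comm

end Derivations

end RestrictedSO

namespace RestrictedSO

/-! ### Fragments with countably many symbols. -/

section Fragments

variable {L : FirstOrder.Language.{u, v}} {Θ : DefClass L}

/-- The symbols that occur in a term. -/
def termSyms {α : Type} : L.Term α → Set L.Symbols
  | .var _ => ∅
  | .func f ts => {Sum.inl ⟨_, f⟩} ∪ ⋃ i, termSyms (ts i)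

/-- The symbols that occur in a first-order formula. -/
def formulaSyms {α : Type} : {n : ℕ} → L.BoundedFormula α n → Set L.Symbols
  | _, .falsum => ∅
  | _, .equal t s => termSyms t ∪ termSyms s
  | _, .rel R ts => {Sum.inr ⟨_, R⟩} ∪ ⋃ i, termSyms (ts i)
  | _, .imp φ ψ => formulaSyms φ ∪ formulaSyms ψ
  | _, .all φ => formulaSyms φ

theorem countable_termSyms {α : Type} (t : L.Term α) : (termSyms t).Countable := by
  induction t with
  | var => exact Set.countable_empty
  | func f ts ih => exact (Set.countable_singleton _).union (Set.countable_iUnion ih)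

theorem countable_formulaSyms {α : Type} {n : ℕ} (χ : L.BoundedFormula α n) :
    (formulaSyms χ).Countable := by
  induction χ with
  | falsum => exact Set.countable_empty
  | equal t s => exact (countable_termSyms t).union (countable_termSyms s)
  | rel R ts =>
    exact (Set.countable_singleton _).union (Set.countable_iUnion fun i => countable_termSyms _)
  | imp χ ξ ih ih' => exact ih.union ih'
  | all χ ih => exact ih

theorem termSyms_subst_subset {α β : Type} {S : Set L.Symbols} {t : L.Term α}
    {σ : α → L.Term β} (ht : termSyms t ⊆ S) (hσ : ∀ i, termSyms (σ i) ⊆ S) :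
    termSyms (t.subst σ) ⊆ S := by
  induction t with
  | var i => exact hσ i
  | func f ts ih =>
    simp only [termSyms, Term.subst, Set.union_subset_iff, Set.iUnion_subset_iff] at ht ⊢
    exact ⟨ht.1, fun i => ih i (ht.2 i)⟩

theorem termSyms_relabel_subset {α β : Type} {S : Set L.Symbols} {t : L.Term α} {g : α → β}
    (ht : termSyms t ⊆ S) : termSyms (t.relabel g) ⊆ S := by
  rw [Term.relabel_eq_subst]
  exact termSyms_subst_subset ht fun i => Set.empty_subset _

namespace Fml

/-- The symbols that occur in a formula. -/
def syms : Fml Θ → Set L.Symbols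
  | equal t s => termSyms t ∪ termSyms s
  | rel R ts => {Sum.inr ⟨_, R⟩} ∪ ⋃ i, termSyms (ts i)
  | rvar _ _ ts => ⋃ i, termSyms (ts i)
  | req _ _ _ => ∅
  | neg φ => syms φ
  | and φ ψ => syms φ ∪ syms ψ
  | all φ => syms φ
  | allR _ φ => syms φ

theorem countable_syms (φ : Fml Θ) : φ.syms.Countable := by
  induction φ with
  | equal t s => exact (countable_termSyms t).union (countable_termSyms s)
  | rel R ts =>
    exact (Set.countable_singleton _).union (Set.countable_iUnion fun i => countable_termSyms _)
  | rvar l i ts => exact Set.countable_iUnion fun i => countable_termSyms _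
  | req => exact Set.countable_empty
  | neg φ ih => exact ih
  | and φ ψ ih ih' => exact ih.union ih'
  | all φ ih => exact ih
  | allR l φ ih => exact ih

variable {S : Set L.Symbols}

theorem syms_iff_subset {φ ψ : Fml Θ} (hφ : φ.syms ⊆ S) (hψ : ψ.syms ⊆ S) :
    (φ.iff ψ).syms ⊆ S :=
  Set.union_subset (Set.union_subset hφ hψ) (Set.union_subset hψ hφ)

theorem syms_allN (n : ℕ) (φ : Fml Θ) : (allN n φ).syms = φ.syms := by
  induction n with
  | zero => rfl
  | succ n ih => exact ih

theorem termSyms_upSubst_subset {σ : ℕ → L.Term ℕ} (hσ : ∀ i, termSyms (σ i) ⊆ S) (i : ℕ) :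
    termSyms (upSubst σ i) ⊆ S := by
  cases i with
  | zero => exact Set.empty_subset _
  | succ i => exact termSyms_relabel_subset (hσ i)

theorem syms_subst_subset {φ : Fml Θ} {σ : ℕ → L.Term ℕ} (hφ : φ.syms ⊆ S)
    (hσ : ∀ i, termSyms (σ i) ⊆ S) : (φ.subst σ).syms ⊆ S := by
  induction φ generalizing σ with
  | equal t s =>
    exact Set.union_subset (termSyms_subst_subset (Set.union_subset_iff.1 hφ).1 hσ)
      (termSyms_subst_subset (Set.union_subset_iff.1 hφ).2 hσ)
  | rel R ts =>
    simp only [syms, subst, Set.union_subset_iff, Set.iUnion_subset_iff] at hφ ⊢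
    exact ⟨hφ.1, fun i => termSyms_subst_subset (hφ.2 i) hσ⟩
  | rvar l i ts =>
    simp only [syms, subst, Set.iUnion_subset_iff] at hφ ⊢
    exact fun i => termSyms_subst_subset (hφ i) hσ
  | req => exact Set.empty_subset _
  | neg φ ih => exact ih hφ hσ
  | and φ ψ ih ih' =>
    exact Set.union_subset (ih (Set.union_subset_iff.1 hφ).1 hσ)
      (ih' (Set.union_subset_iff.1 hφ).2 hσ)
  | all φ ih => exact ih hφ (termSyms_upSubst_subset hσ)
  | allR l φ ih => exact ih hφ hσ

theorem syms_renR (φ : Fml Θ) (ρ : RelSort Θ → ℕ → ℕ) : (φ.renR ρ).syms = φ.syms := by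
  induction φ generalizing ρ with
  | equal => rfl
  | rel => rfl
  | rvar => rfl
  | req => rfl
  | neg φ ih => exact ih ρ
  | and φ ψ ih ih' => exact congrArg₂ _ (ih ρ) (ih' ρ)
  | all φ ih => exact ih ρ
  | allR l φ ih => rw [renR_allR]; exact ih _

theorem syms_ofFirstOrder_subset {α : Type} {n : ℕ} {χ : L.BoundedFormula α n}
    {a : α → L.Term ℕ} {b : Fin n → L.Term ℕ} (hχ : formulaSyms χ ⊆ S)
    (ha : ∀ i, termSyms (a i) ⊆ S) (hb : ∀ i, termSyms (b i) ⊆ S) :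
    (ofFirstOrder χ a b : Fml Θ).syms ⊆ S := by
  have hs : ∀ {n : ℕ} {b : Fin n → L.Term ℕ} {a : α → L.Term ℕ} (_ : ∀ i, termSyms (a i) ⊆ S)
      (_ : ∀ i, termSyms (b i) ⊆ S) (i : α ⊕ Fin n), termSyms (Sum.elim a b i) ⊆ S := by
    rintro n b a ha hb (i | i)
    · exact ha i
    · exact hb i
  induction χ generalizing a with
  | falsum => simp [ofFirstOrder, bot, top, syms, termSyms]
  | equal t s =>
    exact Set.union_subset (termSyms_subst_subset (Set.union_subset_iff.1 hχ).1 (hs ha hb))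
      (termSyms_subst_subset (Set.union_subset_iff.1 hχ).2 (hs ha hb))
  | rel R ts =>
    simp only [syms, ofFirstOrder, formulaSyms, Set.union_subset_iff, Set.iUnion_subset_iff]
      at hχ ⊢
    exact ⟨hχ.1, fun i => termSyms_subst_subset (hχ.2 i) (hs ha hb)⟩
  | imp χ ξ ih ih' =>
    exact Set.union_subset (ih (Set.union_subset_iff.1 hχ).1 ha hb)
      (ih' (Set.union_subset_iff.1 hχ).2 ha hb)
  | all χ ih =>
    refine ih hχ (fun i => termSyms_relabel_subset (ha i)) fun i => ?_
    refine Fin.lastCases ?_ (fun i => ?_) i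
    · rw [Fin.snoc_last]
      exact Set.empty_subset _
    · rw [Fin.snoc_castSucc]
      exact termSyms_relabel_subset (hb i)

end Fml

theorem DefFormula.syms_app_subset {S : Set L.Symbols} {l : ℕ} {θ : DefFormula L l}
    {ts : Fin (l + 1) → L.Term ℕ} {e : Fin θ.params → L.Term ℕ}
    (hθ : formulaSyms θ.formula ⊆ S) (hts : ∀ i, termSyms (ts i) ⊆ S)
    (he : ∀ i, termSyms (e i) ⊆ S) : (θ.app ts e : Fml Θ).syms ⊆ S := by
  refine Fml.syms_ofFirstOrder_subset hθ ?_ fun i => i.elim0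
  rintro (i | i)
  · exact hts i
  · exact he i

/-- Terms are coded injectively by finite lists; those over `S` use only the countable alphabet `C`
of variables and function symbols in `S`. -/
theorem countable_setOf_termSyms_subset {S : Set L.Symbols} (hS : S.Countable) :
    {t : L.Term ℕ | termSyms t ⊆ S}.Countable := by
  let C : Set (ℕ ⊕ Σ i, L.Functions i) := Set.range Sum.inl ∪ Sum.inr '' (Sum.inl ⁻¹' S)
  have hC : C.Countable := (Set.countable_range _).union
    ((hS.preimage_of_injOn Sum.inl_injective.injOn).image _)
  have : {l : List (ℕ ⊕ Σ i, L.Functions i) | ∀ x ∈ l, x ∈ C}.Countable := by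
    have := hC.to_subtype
    rw [← Set.range_list_map_coe]
    exact Set.countable_range _
  refine Set.MapsTo.countable_of_injOn (f := Term.listEncode) ?_
    Term.listEncode_injective.injOn this
  intro t ht
  change ∀ x ∈ t.listEncode, x ∈ C
  change termSyms t ⊆ S at ht
  induction t with
  | var i => simp [Term.listEncode, C]
  | func f ts ih =>
    simp only [termSyms, Set.union_subset_iff, Set.iUnion_subset_iff] at ht
    intro x hx
    simp only [Term.listEncode, List.mem_cons, List.mem_flatMap] at hx
    rcases hx with rfl | ⟨i, -, hi⟩
    · exact Or.inr ⟨_, ht.1 rfl, rfl⟩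
    · exact ih i (ht.2 i) x hi

/-- The height of a formula. -/
def Fml.height : Fml Θ → ℕ
  | neg φ => height φ + 1
  | and φ ψ => max (height φ) (height ψ) + 1
  | all φ => height φ + 1
  | allR _ φ => height φ + 1
  | _ => 0

/-- By induction on the height, a formula arises through one of eight constructors from countably
many data. The sorts form a subtype of `ℕ`, so unions over them are countable. -/
theorem countable_setOf_syms_subset {S : Set L.Symbols} (hS : S.Countable) :
    {φ : Fml Θ | φ.syms ⊆ S}.Countable := by
  have hT := countable_setOf_termSyms_subset hS
  have hTn : ∀ n : ℕ, {ts : Fin n → L.Term ℕ | ∀ i, termSyms (ts i) ⊆ S}.Countable := fun n =>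
    Set.countable_pi fun _ => hT
  have key : ∀ n, {φ : Fml Θ | φ.syms ⊆ S ∧ φ.height < n}.Countable := by
    intro n
    induction n with
    | zero => simp
    | succ n ih =>
      have hR : (Sum.inr ⁻¹' S : Set (Σ n, L.Relations n)).Countable :=
        hS.preimage_of_injOn Sum.inr_injective.injOn
      refine Set.Countable.mono ?_
        ((((((((hT.image2 hT Fml.equal).union
          (hR.biUnion fun r _ => (hTn r.1).image (Fml.rel r.2))).union
          (Set.countable_iUnion fun l : RelSort Θ => Set.countable_iUnion fun i =>
            (hTn (l.1 + 1)).image (Fml.rvar l i))).union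
          (Set.countable_iUnion fun l : RelSort Θ => Set.countable_iUnion fun i =>
            Set.countable_range (Fml.req l i))).union
          (ih.image Fml.neg)).union
          (ih.image2 ih Fml.and)).union
          (ih.image Fml.all)).union
          (Set.countable_iUnion fun l : RelSort Θ => ih.image (Fml.allR l)))
      rintro φ ⟨hφ, hn⟩
      cases φ with
      | equal t s =>
        have := Set.union_subset_iff.1 hφ
        -- The union of eight sets is nested to the left, so the first constructor lies seven levels
        -- deep.
        iterate 7 left
        exact ⟨t, this.1, s, this.2, rfl⟩
      | rel R ts =>
        simp only [Fml.syms, Set.union_subset_iff, Set.iUnion_subset_iff] at hφ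
        iterate 6 left
        right
        exact Set.mem_iUnion₂.2 ⟨⟨_, R⟩, hφ.1 (Set.mem_singleton _), ts, hφ.2, rfl⟩
      | rvar l i ts =>
        simp only [Fml.syms, Set.iUnion_subset_iff] at hφ
        iterate 5 left
        right
        exact Set.mem_iUnion₂.2 ⟨l, i, ts, hφ, rfl⟩
      | req l i j =>
        iterate 4 left
        right
        exact Set.mem_iUnion₂.2 ⟨l, i, j, rfl⟩
      | neg φ =>
        iterate 3 left
        right
        exact ⟨φ, ⟨hφ, Nat.lt_of_succ_lt_succ hn⟩, rfl⟩
      | and φ ψ =>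
        have := Set.union_subset_iff.1 hφ
        have hn := max_lt_iff.1 (Nat.lt_of_succ_lt_succ hn)
        iterate 2 left
        right
        exact ⟨φ, ⟨this.1, hn.1⟩, ψ, ⟨this.2, hn.2⟩, rfl⟩
      | all φ =>
        left
        right
        exact ⟨φ, ⟨hφ, Nat.lt_of_succ_lt_succ hn⟩, rfl⟩
      | allR l φ =>
        right
        exact Set.mem_iUnion.2 ⟨l, φ, ⟨hφ, Nat.lt_of_succ_lt_succ hn⟩, rfl⟩
  refine (Set.countable_iUnion key).mono fun φ hφ => ?_
  exact Set.mem_iUnion.2 ⟨φ.height + 1, hφ, Nat.lt_succ_self _⟩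

variable (Γ : Set (Fml Θ))

/-- The members of `instFamily` that come from formulas all of whose symbols belong to `S`. -/
def instFamilyOver (S : Set L.Symbols) : Set (Set (Lindenbaum Γ)) :=
  ((fun ψ : Fml Θ => {a | ∃ m : ℕ, a = cls Γ (ψ.inst (Term.var m))}) '' {ψ | ψ.syms ⊆ S} ∪
  ⋃ l : RelSort Θ, (fun ψ : Fml Θ => {a | ∃ m : ℕ, a = cls Γ (ψ.instR l (.var m))}) ''
    {ψ | ψ.syms ⊆ S}) ∪
  ⋃ l : RelSort Θ, (fun ψ : Fml Θ => {a | ∃ θ ∈ Θ l.1, ∃ z : Fin θ.params → ℕ,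
    a = cls Γ (ψ.instR l (.defn θ (fun j => Term.var (z j))))}) '' {ψ | ψ.syms ⊆ S}

theorem countable_instFamilyOver {S : Set L.Symbols} (hS : S.Countable) :
    (instFamilyOver Γ S).Countable := by
  have h : {φ : Fml Θ | φ.syms ⊆ S}.Countable := countable_setOf_syms_subset hS
  exact ((h.image _).union (Set.countable_iUnion fun l => h.image _)).union
    (Set.countable_iUnion fun l => h.image _)

theorem instFamilyOver_subset (S : Set L.Symbols) : instFamilyOver Γ S ⊆ instFamily Γ := by
  rintro T ((⟨ψ, -, rfl⟩ | h) | h)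
  · exact Or.inl (Or.inl ⟨ψ, rfl⟩)
  · obtain ⟨l, ψ, -, rfl⟩ := Set.mem_iUnion.1 h
    exact Or.inl (Or.inr ⟨l, ψ, rfl⟩)
  · obtain ⟨l, ψ, -, rfl⟩ := Set.mem_iUnion.1 h
    exact Or.inr ⟨l, ψ, rfl⟩

theorem instFamilyOver_univ : instFamilyOver Γ Set.univ = instFamily Γ := by
  refine (instFamilyOver_subset Γ _).antisymm ?_
  rintro S ((⟨ψ, rfl⟩ | ⟨l, ψ, rfl⟩) | ⟨l, ψ, rfl⟩)
  · exact Or.inl (Or.inl ⟨ψ, Set.subset_univ _, rfl⟩)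
  · exact Or.inl (Or.inr (Set.mem_iUnion.2 ⟨l, ψ, Set.subset_univ _, rfl⟩))
  · exact Or.inr (Set.mem_iUnion.2 ⟨l, ψ, Set.subset_univ _, rfl⟩)

end Fragments

/-! ### Ultrafilters that respect countably many joins and meets. -/

section RasiowaSikorski

variable {B : Type w} [BooleanAlgebra B]

/-- The Rasiowa–Sikorski lemma. -/
theorem exists_ultrafilter_isCompatible {F : Set (Set B)} (hF : F.Countable)
    (hreg : IsRegularFamily F) {b : B} (hb : b ≠ ⊤) :
    ∃ U : Set B, IsUltrafilter U ∧ IsCompatible F U ∧ b ∉ U := by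
  have := hF.to_subtype
  have := Encodable.ofCountable F
  choose j hj using fun S hS => (hreg S hS).1
  choose m hm using fun S hS => (hreg S hS).2
  -- Members `x` of the ideal under construction are the elements declared false.
  let P := {x : B // x ≠ ⊤}
  -- Requirement for a join: it is declared false, or some member of `S` is declared true by placing
  -- its complement below the condition.
  let joins : F → Order.Cofinal P := fun S =>
    { carrier := {x | j S.1 S.2 ≤ x.1 ∨ ∃ s ∈ S.1, sᶜ ≤ x.1}
      isCofinal := by
        intro x
        by_cases h : ∃ s ∈ S.1, x.1 ⊔ sᶜ ≠ ⊤
        · obtain ⟨s, hs, hx⟩ := h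
          exact ⟨⟨x.1 ⊔ sᶜ, hx⟩, Or.inr ⟨s, hs, le_sup_right⟩, le_sup_left (a := x.1)⟩
        -- If no member can be declared true, then `x ⊔ sᶜ = ⊤`, that is `s ≤ x`, for every `s`, so
        -- the join already lies below `x`.
        · push Not at h
          refine ⟨x, Or.inl ?_, le_rfl⟩
          refine (hj S.1 S.2).2 fun s hs => ?_
          have := h s hs
          rw [← codisjoint_iff] at this
          exact (codisjoint_iff_compl_le_right.1 this.symm).trans' (compl_compl s).ge }
  -- Dually, the meet is declared true or some member of `S` is declared false.
  let meets : F → Order.Cofinal P := fun S =>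
    { carrier := {x | (m S.1 S.2)ᶜ ≤ x.1 ∨ ∃ s ∈ S.1, s ≤ x.1}
      isCofinal := by
        intro x
        by_cases h : ∃ s ∈ S.1, x.1 ⊔ s ≠ ⊤
        · obtain ⟨s, hs, hx⟩ := h
          exact ⟨⟨x.1 ⊔ s, hx⟩, Or.inr ⟨s, hs, le_sup_right⟩, le_sup_left (a := x.1)⟩
        · push Not at h
          refine ⟨x, Or.inl ?_, le_rfl⟩
          refine compl_le_iff_compl_le.1 ((hm S.1 S.2).2 fun s hs => ?_)
          have := h s hs
          rw [← codisjoint_iff] at this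
          exact codisjoint_iff_compl_le_right.1 this }
  -- Conditions grow stronger upwards. This ideal of conditions contains `b` and meets each of the
  -- countably many requirements.
  let I := Order.idealOfCofinals (⟨b, hb⟩ : P) (Sum.elim joins meets)
  -- The ideal of `B` generated by these conditions is proper because no condition is `⊤`. The
  -- complement of a maximal ideal above it is the ultrafilter.
  let J : Order.Ideal B :=
    { carrier := {y | ∃ x ∈ I, y ≤ x.1}
      lower' := fun y z hzy ⟨x, hx, hyx⟩ => ⟨x, hx, hzy.trans hyx⟩
      nonempty' := ⟨b, _, Order.mem_idealOfCofinals _ _, le_rfl⟩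
      directed' := by
        rintro y ⟨x, hx, hyx⟩ y' ⟨x', hx', hyx'⟩
        obtain ⟨z, hz, hxz, hxz'⟩ := I.directed x hx x' hx'
        exact ⟨z.1, ⟨z, hz, le_rfl⟩, hyx.trans hxz, hyx'.trans hxz'⟩ }
  have hJ : J.IsProper := by
    refine Order.Ideal.isProper_of_notMem (p := ⊤) ?_
    rintro ⟨x, -, hx⟩
    exact x.2 (top_le_iff.1 hx)
  obtain ⟨N, hJN, hN⟩ := hJ.exists_le_maximal
  have hp : N.IsPrime := inferInstance
  have hbot : ∀ a, aᶜ ∈ N ↔ a ∉ N := fun a =>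
    ⟨fun h h' => hp.toIsProper.notMem_of_compl_mem h h', hp.compl_mem_of_notMem⟩
  have hU : IsUltrafilter {a | a ∉ N} :=
    { top_mem := hp.toIsProper.top_notMem
      bot_notMem := fun h => h N.bot_mem
      inf_mem := fun a ha c hc h => (hp.mem_or_mem h).elim ha hc
      mem_of_le := fun a ha c hac h => ha (N.lower hac h)
      mem_or_compl_mem := fun a => by
        by_cases h : a ∈ N
        · exact Or.inr fun h' => (hbot a).1 h' h
        · exact Or.inl h }
  refine ⟨{a | a ∉ N}, hU, fun S hS => ⟨fun a ha => ⟨fun haN => ?_, ?_⟩,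
    fun a ha => ⟨fun haN s hs => hU.mem_of_le a haN s (ha.1 hs), fun h => ?_⟩⟩, fun h => h ?_⟩
  · obtain rfl := ha.unique (hj S hS)
    obtain ⟨x, hx, hxI⟩ := Order.cofinal_meets_idealOfCofinals (⟨b, hb⟩ : P)
      (Sum.elim joins meets) (Sum.inl ⟨S, hS⟩)
    rcases hx with hx | ⟨s, hs, hx⟩
    · exact absurd (hJN ⟨x, hxI, hx⟩) haN
    · exact ⟨s, hs, (hbot s).1 (hJN ⟨x, hxI, hx⟩)⟩
  · rintro ⟨s, hs, hsN⟩
    exact hU.mem_of_le s hsN a (ha.1 hs)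
  · obtain rfl := ha.unique (hm S hS)
    obtain ⟨x, hx, hxI⟩ := Order.cofinal_meets_idealOfCofinals (⟨b, hb⟩ : P)
      (Sum.elim joins meets) (Sum.inr ⟨S, hS⟩)
    rcases hx with hx | ⟨s, hs, hx⟩
    · exact (hbot _).1 (hJN ⟨x, hxI, hx⟩)
    · exact absurd (hJN ⟨x, hxI, hx⟩) (h hs)
  · exact hJN ⟨_, Order.mem_idealOfCofinals _ _, le_rfl⟩

end RasiowaSikorski

end RestrictedSO

namespace RestrictedSO

/-! ### The canonical structure and the truth lemma. -/

section CanonicalModel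

variable {L : FirstOrder.Language.{u, v}} {Θ : DefClass L} {Γ : Set (Fml Θ)}
  {U : Set (Lindenbaum Γ)}

open Fml

namespace IsUltrafilter

theorem mem_of_provable (hU : IsUltrafilter U) {φ : Fml Θ} (h : Provable Γ φ) : cls Γ φ ∈ U :=
  hU.mem_of_le _ hU.top_mem _ (Provable.of_taut₁ h fun v hn ha => by
    simp only [Fml.imp, hn, ha]; tauto)

theorem mem_and (hU : IsUltrafilter U) {φ ψ : Fml Θ} :
    cls Γ (φ.and ψ) ∈ U ↔ cls Γ φ ∈ U ∧ cls Γ ψ ∈ U :=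
  ⟨fun h => ⟨hU.mem_of_le _ h _ (inf_le_left (a := cls Γ φ) (b := cls Γ ψ)),
    hU.mem_of_le _ h _ (inf_le_right (a := cls Γ φ) (b := cls Γ ψ))⟩,
    fun h => hU.inf_mem _ h.1 _ h.2⟩

theorem mem_neg (hU : IsUltrafilter U) {φ : Fml Θ} : cls Γ φ.neg ∈ U ↔ cls Γ φ ∉ U := by
  refine ⟨fun h h' => hU.bot_notMem ?_, fun h => (hU.mem_or_compl_mem _).resolve_left h⟩
  have := hU.inf_mem _ h' _ h
  rwa [cls_neg, inf_compl_self] at this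

theorem mem_imp (hU : IsUltrafilter U) {φ ψ : Fml Θ} :
    cls Γ (φ.imp ψ) ∈ U ↔ (cls Γ φ ∈ U → cls Γ ψ ∈ U) := by
  rw [Fml.imp, hU.mem_neg, hU.mem_and, hU.mem_neg]; tauto

theorem mem_iff (hU : IsUltrafilter U) {φ ψ : Fml Θ} :
    cls Γ (φ.iff ψ) ∈ U ↔ (cls Γ φ ∈ U ↔ cls Γ ψ ∈ U) := by
  rw [Fml.iff, hU.mem_and, hU.mem_imp, hU.mem_imp]; tauto

theorem bot_notMem' (hU : IsUltrafilter U) : cls Γ (bot : Fml Θ) ∉ U := hU.bot_notMem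

theorem mem_of_axm_imp (hU : IsUltrafilter U) {φ ψ : Fml Θ} (h : Axm (φ.imp ψ))
    (hφ : cls Γ φ ∈ U) : cls Γ ψ ∈ U := hU.mem_imp.1 (hU.mem_of_provable (.ax h)) hφ

theorem mem_eq_refl (hU : IsUltrafilter U) (t : L.Term ℕ) : cls Γ (.equal t t) ∈ U :=
  hU.mem_of_provable (.ax (.eqRefl t))

/-- `eqSubst` replaces at one marked place. The variable `0` marks coordinate `k`, and the other
values of `σ` are shifted out of its way. -/
theorem mem_subst_update (hU : IsUltrafilter U) {φ : Fml Θ} {σ : ℕ → L.Term ℕ} {k : ℕ}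
    {t : L.Term ℕ} (ht : cls Γ (.equal (σ k) t) ∈ U) (hφ : cls Γ (φ.subst σ) ∈ U) :
    cls Γ (φ.subst (Function.update σ k t)) ∈ U := by
  have hinst : ∀ s : L.Term ℕ,
      (φ.subst (Function.update (fun i => (σ i).relabel Nat.succ) k (Term.var 0))).inst s =
        φ.subst (Function.update σ k s) := by
    intro s
    rw [inst, subst_subst]
    congr 1
    funext i
    by_cases h : i = k
    · subst h
      simp [Term.subst, consVal]
    · simp only [Function.update_of_ne h, Term.relabel_subst, consVal]
      exact Term.subst_var _
  have := hU.mem_of_axm_imp (.eqSubst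
    (φ.subst (Function.update (fun i => (σ i).relabel Nat.succ) k (Term.var 0))) (σ k) t) ht
  rw [hinst, hinst, Function.update_eq_self] at this
  exact hU.mem_imp.1 this hφ

/-- Coordinates are exchanged one at a time; by finite support finitely many exchanges suffice. -/
theorem mem_subst_congr (hU : IsUltrafilter U) {φ : Fml Θ} {σ τ : ℕ → L.Term ℕ}
    (h : ∀ i, cls Γ (.equal (σ i) (τ i)) ∈ U) (hφ : cls Γ (φ.subst σ) ∈ U) :
    cls Γ (φ.subst τ) ∈ U := by
  have key : ∀ N, cls Γ (φ.subst fun i => if i < N then τ i else σ i) ∈ U := by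
    intro N
    induction N with
    | zero => simpa using hφ
    | succ N ih =>
      have := hU.mem_subst_update (k := N) (t := τ N) (by simpa using h N) ih
      convert this using 3
      funext i
      by_cases hi : i = N
      · subst hi; simp
      · rw [Function.update_of_ne hi]
        exact if_congr (by omega) rfl rfl
  obtain ⟨N, hN⟩ := φ.exists_support
  have := key N
  rwa [hN _ τ fun i hi => if_pos hi] at this

theorem mem_eq_symm (hU : IsUltrafilter U) {t s : L.Term ℕ} (h : cls Γ (.equal t s) ∈ U) :
    cls Γ (.equal s t) ∈ U :=
  hU.mem_subst_update (φ := .equal (.var 0) (.var 1)) (σ := fun _ => t) (k := 0) h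
    (hU.mem_eq_refl t)

theorem mem_eq_trans (hU : IsUltrafilter U) {t s r : L.Term ℕ} (h : cls Γ (.equal t s) ∈ U)
    (h' : cls Γ (.equal s r) ∈ U) : cls Γ (.equal t r) ∈ U :=
  hU.mem_subst_update (φ := .equal (.var 0) (.var 1)) (σ := consVal t fun _ => s) (k := 1) h' h

theorem mem_preSubst_eq (hU : IsUltrafilter U) {n : ℕ} {ts ss : Fin n → L.Term ℕ}
    (h : ∀ i, cls Γ (.equal (ts i) (ss i)) ∈ U) (σ : ℕ → L.Term ℕ) (i : ℕ) :
    cls Γ (.equal (preSubst n ts σ i) (preSubst n ss σ i)) ∈ U := by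
  unfold preSubst
  split_ifs with hi
  · exact h _
  · exact hU.mem_eq_refl _

theorem mem_func_congr (hU : IsUltrafilter U) {n : ℕ} (f : L.Functions n)
    {ts ss : Fin n → L.Term ℕ} (h : ∀ i, cls Γ (.equal (ts i) (ss i)) ∈ U) :
    cls Γ (.equal (Term.func f ts) (Term.func f ss)) ∈ U := by
  -- The variables `i + n` keep the value `ts i` and form the fixed left side; those below `n`
  -- change from `ts` to `ss`.
  have := hU.mem_subst_congr
    (φ := .equal (.func f fun i => .var (i.1 + n)) (.func f fun i => .var i.1))
    (hU.mem_preSubst_eq h (preSubst n ts Term.var))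
  simp only [Fml.subst, Term.subst, preSubst_add, preSubst_val] at this
  exact this (hU.mem_eq_refl _)

theorem mem_rel_congr (hU : IsUltrafilter U) {n : ℕ} (R : L.Relations n)
    {ts ss : Fin n → L.Term ℕ} (h : ∀ i, cls Γ (.equal (ts i) (ss i)) ∈ U)
    (hR : cls Γ (.rel R ts) ∈ U) : cls Γ (.rel R ss) ∈ U := by
  have := hU.mem_subst_congr (φ := .rel R fun i => .var i.1) (hU.mem_preSubst_eq h Term.var)
  simp only [Fml.subst, Term.subst, preSubst_val] at this
  exact this hR

theorem mem_rvar_congr (hU : IsUltrafilter U) (l : RelSort Θ) (m : ℕ)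
    {ts ss : Fin (l.1 + 1) → L.Term ℕ} (h : ∀ i, cls Γ (.equal (ts i) (ss i)) ∈ U)
    (hR : cls Γ (.rvar l m ts) ∈ U) : cls Γ (.rvar l m ss) ∈ U := by
  have := hU.mem_subst_congr (φ := .rvar l m fun i => .var i.1) (hU.mem_preSubst_eq h Term.var)
  simp only [Fml.subst, Term.subst, preSubst_val] at this
  exact this hR

/-- `Quot` identifies along the generated equivalence relation; by the identity axioms the given
relation already is one. -/
theorem hat_eq_hat_iff (hU : IsUltrafilter U) {x y : ℕ} :
    hat U x = hat U y ↔ cls Γ (.equal (Term.var x) (Term.var y)) ∈ U := by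
  refine ⟨fun h => ?_, fun h => Quot.sound h⟩
  have e : Equivalence fun x y : ℕ => cls Γ (.equal (Term.var x) (Term.var y)) ∈ U :=
    ⟨fun x => hU.mem_eq_refl _, hU.mem_eq_symm, hU.mem_eq_trans⟩
  exact e.eqvGen_iff.1 (Quot.eqvGen_exact h)

theorem relMap_hat_iff (hU : IsUltrafilter U) {n : ℕ} (R : L.Relations n) (x : Fin n → ℕ) :
    Structure.RelMap R (fun i => hat U (x i)) ↔ cls Γ (.rel R fun i => Term.var (x i)) ∈ U := by
  refine ⟨?_, fun h => ⟨x, rfl, h⟩⟩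
  rintro ⟨y, hy, h⟩
  exact hU.mem_rel_congr R (fun i => hU.hat_eq_hat_iff.1 (congrFun hy i).symm) h

theorem mem_canonicalRel_iff (hU : IsUltrafilter U) (l : RelSort Θ) (m : ℕ)
    (x : Fin (l.1 + 1) → ℕ) :
    (fun i => hat U (x i)) ∈ canonicalRel U l m ↔
      cls Γ (.rvar l m fun i => Term.var (x i)) ∈ U := by
  refine ⟨?_, fun h => ⟨x, rfl, h⟩⟩
  rintro ⟨y, hy, h⟩
  exact hU.mem_rvar_congr l m (fun i => hU.hat_eq_hat_iff.1 (congrFun hy i).symm) h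

end IsUltrafilter

theorem hat_surjective : Function.Surjective (hat U) := Quot.mk_surjective

theorem exists_eq_hat_comp {ι : Type*} (d : ι → CanonicalDomain U) :
    ∃ x : ι → ℕ, d = fun i => hat U (x i) := by
  choose x hx using fun i => hat_surjective (d i)
  exact ⟨x, funext fun i => (hx i).symm⟩

/-- Ultrafilters for which quantified formulas with symbols in `S` are determined by their
instances. -/
structure IsGeneric (S : Set L.Symbols) (U : Set (Lindenbaum Γ)) : Prop where
  isUltrafilter : IsUltrafilter U
  mem_all : ∀ ψ : Fml Θ, ψ.syms ⊆ S →
    (cls Γ (all ψ) ∈ U ↔ ∀ m, cls Γ (ψ.inst (Term.var m)) ∈ U)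
  mem_allR : ∀ (l : RelSort Θ) (ψ : Fml Θ), ψ.syms ⊆ S →
    (cls Γ (allR l ψ) ∈ U ↔ ∀ m, cls Γ (ψ.instR l (.var m)) ∈ U)
  mem_allR_defn : ∀ (l : RelSort Θ) (ψ : Fml Θ), ψ.syms ⊆ S →
    (cls Γ (allR l ψ) ∈ U ↔ ∀ θ ∈ Θ l.1, ∀ z : Fin θ.params → ℕ,
      cls Γ (ψ.instR l (.defn θ fun j => Term.var (z j))) ∈ U)

theorem IsCompatible.isGeneric {S : Set L.Symbols} (hU : IsUltrafilter U)
    (hc : IsCompatible (instFamilyOver Γ S) U) : IsGeneric S U where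
  isUltrafilter := hU
  mem_all ψ hψ := by
    refine ((hc _ (Or.inl (Or.inl ⟨ψ, hψ, rfl⟩))).2 _ (isGLB_inst Γ ψ)).trans ⟨fun h m =>
      h ⟨m, rfl⟩, ?_⟩
    rintro h _ ⟨m, rfl⟩
    exact h m
  mem_allR l ψ hψ := by
    refine ((hc _ (Or.inl (Or.inr (Set.mem_iUnion.2 ⟨l, ψ, hψ, rfl⟩)))).2 _
      (isGLB_instR_var Γ l ψ)).trans ⟨fun h m => h ⟨m, rfl⟩, ?_⟩
    rintro h _ ⟨m, rfl⟩
    exact h m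
  mem_allR_defn l ψ hψ := by
    refine ((hc _ (Or.inr (Set.mem_iUnion.2 ⟨l, ψ, hψ, rfl⟩))).2 _
      (isGLB_instR_defn Γ l ψ)).trans ⟨fun h θ hθ z => h ⟨θ, hθ, z, rfl⟩, ?_⟩
    rintro h _ ⟨θ, hθ, z, rfl⟩
    exact h θ hθ z

namespace IsGeneric

variable {S : Set L.Symbols}

/-- Variables suffice as a domain: otherwise `∀ y, f(x̄) ≠ y` would belong to `U`, and its instance
at the term `f(x̄)` contradicts reflexivity. -/
theorem exists_mem_func_eq (hU : IsGeneric S U) {n : ℕ} {f : L.Functions n}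
    (hf : Sum.inl ⟨n, f⟩ ∈ S) (x : Fin n → ℕ) :
    ∃ y : ℕ, cls Γ (.equal (Term.func f fun i => Term.var (x i)) (Term.var y)) ∈ U := by
  by_contra! h
  -- The arguments are `x i + 1` because `0` is the variable about to be quantified.
  have hs : (neg (.equal (.func f fun i => .var (x i + 1)) (.var 0)) : Fml Θ).syms ⊆ S := by
    simpa [syms, termSyms] using hf
  have := (hU.mem_all _ hs).2 fun m => hU.isUltrafilter.mem_neg.2 (h m)
  have := hU.isUltrafilter.mem_of_axm_imp (.allInst _ (.func f fun i => .var (x i))) this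
  exact hU.isUltrafilter.mem_neg.1 this (hU.isUltrafilter.mem_eq_refl _)

/-- The choice operator may have used other representatives `x'` of the same classes; congruence
carries its value back to `x`. -/
theorem exists_funMap_eq (hU : IsGeneric S U) {n : ℕ} {f : L.Functions n}
    (hf : Sum.inl ⟨n, f⟩ ∈ S) (x : Fin n → ℕ) :
    ∃ y : ℕ, Structure.funMap f (fun i => hat U (x i)) = hat U y ∧
      cls Γ (.equal (Term.func f fun i => Term.var (x i)) (Term.var y)) ∈ U := by
  obtain ⟨y, hy⟩ := hU.exists_mem_func_eq hf x
  obtain ⟨x', y', hx, hy', h⟩ := Classical.epsilon_spec (p := fun b => ∃ (x' : Fin n → ℕ) (y : ℕ),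
    (fun i => hat U (x i)) = (fun i => hat U (x' i)) ∧ b = hat U y ∧
      cls Γ (.equal (Term.func f (fun i => Term.var (x' i))) (Term.var y)) ∈ U)
    ⟨_, x, y, rfl, rfl, hy⟩
  exact ⟨y', hy', hU.isUltrafilter.mem_eq_trans (hU.isUltrafilter.mem_func_congr f fun i =>
    hU.isUltrafilter.hat_eq_hat_iff.1 (congrFun hx i)) h⟩

theorem exists_realize_eq (hU : IsGeneric S U) {α : Type} {t : L.Term α} (ht : termSyms t ⊆ S)
    (x : α → ℕ) : ∃ y : ℕ, t.realize (fun i => hat U (x i)) = hat U y ∧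
      cls Γ (.equal (t.subst fun i => Term.var (x i)) (Term.var y)) ∈ U := by
  induction t with
  | var i => exact ⟨x i, rfl, hU.isUltrafilter.mem_eq_refl _⟩
  | func f ts ih =>
    simp only [termSyms, Set.union_subset_iff, Set.iUnion_subset_iff] at ht
    choose y hy h using fun i => ih i (ht.2 i)
    obtain ⟨z, hz, hfz⟩ := hU.exists_funMap_eq (ht.1 (Set.mem_singleton _)) y
    refine ⟨z, ?_, hU.isUltrafilter.mem_eq_trans (hU.isUltrafilter.mem_func_congr f h) hfz⟩
    simp only [Term.realize, hy, hz]

theorem mem_equal_iff (hU : IsGeneric S U) {α : Type} {t s : L.Term α} (ht : termSyms t ⊆ S)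
    (hs : termSyms s ⊆ S) (x : α → ℕ) :
    cls Γ (.equal (t.subst fun i => Term.var (x i)) (s.subst fun i => Term.var (x i))) ∈ U ↔
      t.realize (fun i => hat U (x i)) = s.realize fun i => hat U (x i) := by
  have hF := hU.isUltrafilter
  obtain ⟨y, hy, h⟩ := hU.exists_realize_eq ht x
  obtain ⟨y', hy', h'⟩ := hU.exists_realize_eq hs x
  rw [hy, hy', hF.hat_eq_hat_iff]
  exact ⟨fun k => hF.mem_eq_trans (hF.mem_eq_symm h) (hF.mem_eq_trans k h'),
    fun k => hF.mem_eq_trans h (hF.mem_eq_trans k (hF.mem_eq_symm h'))⟩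

theorem mem_rel_iff (hU : IsGeneric S U) {α : Type} {n : ℕ} (R : L.Relations n)
    {ts : Fin n → L.Term α} (ht : ∀ i, termSyms (ts i) ⊆ S) (x : α → ℕ) :
    cls Γ (.rel R fun i => (ts i).subst fun i => Term.var (x i)) ∈ U ↔
      Structure.RelMap R fun i => (ts i).realize fun i => hat U (x i) := by
  have hF := hU.isUltrafilter
  choose y hy h using fun i => hU.exists_realize_eq (ht i) x
  simp only [hy, hF.relMap_hat_iff]
  exact ⟨hF.mem_rel_congr R h, hF.mem_rel_congr R fun i => hF.mem_eq_symm (h i)⟩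

theorem mem_rvar_iff (hU : IsGeneric S U) (l : RelSort Θ) (m : ℕ)
    {ts : Fin (l.1 + 1) → L.Term ℕ} (ht : ∀ i, termSyms (ts i) ⊆ S) (x : ℕ → ℕ) :
    cls Γ (.rvar l m fun i => (ts i).subst fun i => Term.var (x i)) ∈ U ↔
      (fun i => (ts i).realize fun i => hat U (x i)) ∈ canonicalRel U l m := by
  have hF := hU.isUltrafilter
  choose y hy h using fun i => hU.exists_realize_eq (ht i) x
  simp only [hy, hF.mem_canonicalRel_iff]
  exact ⟨hF.mem_rvar_congr l m h, hF.mem_rvar_congr l m fun i => hF.mem_eq_symm (h i)⟩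

/-- The first-order case comes separately, since the range of the relation quantifiers is defined
through `Realize` and must be known before the truth lemma. -/
theorem mem_ofFirstOrder_iff (hU : IsGeneric S U) {α : Type} {n : ℕ} {χ : L.BoundedFormula α n}
    (hχ : formulaSyms χ ⊆ S) (a : α → ℕ) (b : Fin n → ℕ) :
    cls Γ (ofFirstOrder χ (fun i => Term.var (a i)) fun i => Term.var (b i)) ∈ U ↔
      χ.Realize (fun i => hat U (a i)) fun i => hat U (b i) := by
  have hF := hU.isUltrafilter
  have hvar : ∀ {n : ℕ} (b : Fin n → ℕ), Sum.elim (fun i => Term.var (L := L) (a i))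
      (fun i => Term.var (b i)) = fun i => Term.var (Sum.elim a b i) := by
    intro n b
    funext i
    cases i <;> rfl
  have hhat : ∀ {n : ℕ} (b : Fin n → ℕ), Sum.elim (fun i => hat U (a i))
      (fun i => hat U (b i)) = fun i => hat U (Sum.elim a b i) := by
    intro n b
    funext i
    cases i <;> rfl
  induction χ with
  | falsum => exact iff_of_false hF.bot_notMem' id
  | equal t s =>
    simp only [ofFirstOrder, BoundedFormula.Realize, hvar, hhat]
    exact hU.mem_equal_iff (Set.union_subset_iff.1 hχ).1 (Set.union_subset_iff.1 hχ).2 _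
  | rel R ts =>
    simp only [formulaSyms, Set.union_subset_iff, Set.iUnion_subset_iff] at hχ
    simp only [ofFirstOrder, BoundedFormula.Realize, hvar, hhat]
    exact hU.mem_rel_iff R hχ.2 _
  | imp χ ξ ih ih' =>
    simp only [ofFirstOrder, BoundedFormula.Realize, hF.mem_imp]
    exact imp_congr (ih (Set.union_subset_iff.1 hχ).1 b) (ih' (Set.union_subset_iff.1 hχ).2 b)
  | @all n χ ih =>
    simp only [ofFirstOrder, BoundedFormula.Realize]
    rw [hU.mem_all, hat_surjective.forall]
    · refine forall_congr' fun m => ?_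
      have hsnoc : Fin.snoc (fun i => hat U (b i)) (hat U m) =
          fun i => hat U (Fin.snoc (α := fun _ => ℕ) b m i) := by
        funext i
        refine Fin.lastCases ?_ (fun i => ?_) i
        · simp only [Fin.snoc_last]
        · simp only [Fin.snoc_castSucc]
      rw [hsnoc, inst, subst_ofFirstOrder]
      refine Iff.trans ?_ (ih hχ (Fin.snoc (α := fun _ => ℕ) b m))
      refine iff_of_eq (congrArg (cls Γ · ∈ U) (congrArg₂ _ rfl (funext fun i => ?_)))
      refine Fin.lastCases ?_ (fun i => ?_) i
      · simp only [Fin.snoc_last]; rfl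
      · simp only [Fin.snoc_castSucc]; rfl
    · refine syms_ofFirstOrder_subset hχ (fun i => Set.empty_subset _) fun i => ?_
      refine Fin.lastCases ?_ (fun i => ?_) i
      · rw [Fin.snoc_last]; exact Set.empty_subset _
      · rw [Fin.snoc_castSucc]; exact Set.empty_subset _

theorem mem_app_iff (hU : IsGeneric S U) {l : ℕ} {θ : DefFormula L l}
    (hθ : formulaSyms θ.formula ⊆ S) (x : Fin (l + 1) → ℕ) (z : Fin θ.params → ℕ) :
    cls Γ (θ.app (fun i => Term.var (x i)) fun i => Term.var (z i)) ∈ U ↔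
      θ.formula.Realize (Sum.elim (fun i => hat U (x i)) fun i => hat U (z i)) := by
  have := hU.mem_ofFirstOrder_iff hθ (Sum.elim x z) Fin.elim0
  have h1 : (Sum.elim (fun i => Term.var (L := L) (x i)) fun i => Term.var (z i)) =
      fun i => Term.var (Sum.elim x z i) := by
    funext i; cases i <;> rfl
  have h2 : (Sum.elim (fun i => hat U (x i)) fun i => hat U (z i)) =
      fun i => hat U (Sum.elim x z i) := by
    funext i; cases i <;> rfl
  rw [DefFormula.app, Formula.Realize, h1, h2]
  rwa [Subsingleton.elim (fun i : Fin 0 => Term.var (L := L) (Fin.elim0 i : ℕ)) Fin.elim0,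
    Subsingleton.elim (fun i : Fin 0 => hat U (Fin.elim0 i)) default] at this

theorem mem_allN_iff (hU : IsGeneric S U) {n : ℕ} {φ : Fml Θ} (hφ : φ.syms ⊆ S) (ρ : ℕ → ℕ) :
    cls Γ ((allN n φ).subst fun i => Term.var (ρ i)) ∈ U ↔
      ∀ x : Fin n → ℕ, cls Γ (φ.subst fun i => Term.var (preSubst n x ρ i)) ∈ U := by
  induction n generalizing ρ with
  | zero => exact ⟨fun h x => h, fun h => h Fin.elim0⟩
  | succ n ih =>
    rw [allN, Fml.subst, hU.mem_all]
    · simp only [inst_subst_upSubst]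
      have hc : ∀ m : ℕ, (consVal (Term.var m) fun i => Term.var (L := L) (ρ i)) =
          fun i => Term.var (consVal m ρ i) := by
        intro m
        funext i
        cases i <;> rfl
      simp only [hc, ih]
      refine ⟨fun h x => ?_, fun h m x => ?_⟩
      · rw [← preSubst_snoc]
        exact h _ _
      · have := h (Fin.snoc (α := fun _ => ℕ) x m)
        rw [← preSubst_snoc] at this
        simpa only [Fin.snoc_last, Fin.snoc_castSucc] using this
    · refine syms_subst_subset (by rwa [syms_allN]) (termSyms_upSubst_subset fun i => ?_)
      exact Set.empty_subset _

theorem mem_allN_iff' (hU : IsGeneric S U) {n : ℕ} {φ : Fml Θ} (hφ : φ.syms ⊆ S) :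
    cls Γ (allN n φ) ∈ U ↔
      ∀ x : Fin n → ℕ, cls Γ (φ.subst fun i => Term.var (preSubst n x id i)) ∈ U := by
  rw [← hU.mem_allN_iff hφ id]
  exact iff_of_eq (congrArg (cls Γ · ∈ U) (Fml.subst_var _).symm)

theorem mem_req_iff (hU : IsGeneric S U) (l : RelSort Θ) (i j : ℕ) :
    cls Γ (.req l i j) ∈ U ↔ canonicalRel U l i = canonicalRel U l j := by
  have hF := hU.isUltrafilter
  have h := hF.mem_of_provable (.ax (Γ := Γ) (.extensionality l))
  -- The outer quantifier binds the relation variable `1`, so it is the one to receive `i`.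
  replace h := hF.mem_of_axm_imp (.allRInst l _ i) h
  rw [instR_var_eq_renR, renR_allR] at h
  replace h := hF.mem_of_axm_imp (.allRInst l _ j) h
  rw [instR_renR_upRen, renR, substR_iff, ← renR, ← renR, hF.mem_iff, renR_allN] at h
  have h0 : instRen l j (instRen l i fun _ i => i) l 0 = j := by simp [instRen, consVal]
  have h1 : instRen l j (instRen l i fun _ i => i) l 1 = i := by simp [instRen, consVal]
  rw [renR, renR, substR_iff, substR, substR, substR, h0, h1] at h
  simp only [RelExpr.app, RelExpr.eq] at h
  rw [← h, hU.mem_allN_iff']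
  · simp only [subst_iff, hF.mem_iff, Fml.subst, Term.subst, preSubst_val, Set.ext_iff]
    refine ⟨fun H d => ?_, fun H x => ?_⟩
    · obtain ⟨x, rfl⟩ := exists_eq_hat_comp d
      rw [hF.mem_canonicalRel_iff, hF.mem_canonicalRel_iff, H]
    · rw [← hF.mem_canonicalRel_iff, ← hF.mem_canonicalRel_iff, H]
  · refine syms_iff_subset ?_ ?_ <;> simp [syms, termSyms]

/-- Comprehension puts `∃ V ∀ x̄ (V x̄ ↔ θ(x̄, z̄))` into `U`, and since `U` respects the meet over
relation variables, some `V_m` is a witness. -/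
theorem exists_canonicalRel_eq (hU : IsGeneric S U) (l : RelSort Θ) {θ : DefFormula L l.1}
    (hθ : θ ∈ Θ l.1) (hS : formulaSyms θ.formula ⊆ S) (z : Fin θ.params → ℕ) :
    ∃ m, canonicalRel U l m =
      {d | θ.formula.Realize (Sum.elim d fun i => hat U (z i))} := by
  have hF := hU.isUltrafilter
  have hvar : ∀ n : ℕ, termSyms (Term.var n : L.Term ℕ) ⊆ S := fun n => Set.empty_subset _
  have h := hF.mem_imp.1 (hF.mem_of_provable (provable_allN_subst_imp θ.params _
    (fun j => Term.var (z j)) Term.var)) (hF.mem_of_provable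
      ((Provable.ax (.comprehension l θ hθ)).subst _))
  set ψ : Fml Θ := (rvar l 0 (fun j => Term.var j.1)).iff
    (θ.app (fun j => Term.var j.1) (fun j => Term.var (j.1 + (l.1 + 1)))) with hψ
  have hψS : ψ.syms ⊆ S := syms_iff_subset (by simp [syms, termSyms])
    (DefFormula.syms_app_subset hS (fun _ => hvar _) fun _ => hvar _)
  have hv : preSubst θ.params (fun j => Term.var (z j)) Term.var =
      fun i => Term.var (L := L) (preSubst θ.params z id i) := by
    funext i
    unfold preSubst
    split_ifs <;> rfl
  rw [hv, exR, Fml.subst, hF.mem_neg, Fml.subst, hU.mem_allR _ _ (syms_subst_subset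
    (show (neg (allN (l.1 + 1) ψ)).syms ⊆ S from (syms_allN _ _).trans_subset hψS)
    fun _ => hvar _)] at h
  push Not at h
  obtain ⟨m, hm⟩ := h
  have hm' := (not_iff_not.2 hF.mem_neg).1 hm
  rw [not_not] at hm'
  change cls Γ (instR l (.var m) ((allN (l.1 + 1) ψ).subst _)) ∈ U at hm'
  rw [instR_var_eq_renR, ← renR_subst, renR_allN,
    hU.mem_allN_iff ((syms_renR _ _).trans_subset hψS)] at hm'
  refine ⟨m, Set.ext fun d => ?_⟩
  obtain ⟨x, rfl⟩ := exists_eq_hat_comp d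
  have hx := hm' x
  have h0 : instRen l m (fun _ i => i) l 0 = m := by simp [instRen, consVal]
  rw [hψ, renR, substR_iff, subst_iff, hF.mem_iff, substR, h0, DefFormula.substR_app,
    DefFormula.subst_app] at hx
  simp only [RelExpr.app, Fml.subst, Term.subst, preSubst_val, preSubst_add] at hx
  rw [hF.mem_canonicalRel_iff, hx, hU.mem_app_iff hS]
  rfl

/-- The instance of `∀ V ¬ ∀ x̄ (V x̄ ↔ V_m x̄)` at `V_m` is refuted, so this formula is not in `U`.
As `U` also respects the meet over definable instances, an instance at some `θ(·, z̄)` is missing as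
well, and this `θ(·, z̄)` defines `F_m`. -/
theorem canonicalRel_mem_definableRels (hU : IsGeneric S U) (l : RelSort Θ)
    (hS : ∀ θ ∈ Θ l.1, formulaSyms θ.formula ⊆ S) (m : ℕ) :
    canonicalRel U l m ∈ definableRels Θ (CanonicalDomain U) l.1 := by
  have hF := hU.isUltrafilter
  have hvar : ∀ n : ℕ, termSyms (Term.var n : L.Term ℕ) ⊆ S := fun n => Set.empty_subset _
  -- Under the quantifier over `V`, the relation variable `V_m` has index `m + 1`.
  set ψ : Fml Θ := (rvar l 0 (fun j => Term.var j.1)).iff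
    (rvar l (m + 1) (fun j => Term.var j.1)) with hψ
  have hψS : ψ.syms ⊆ S := syms_iff_subset (by simp [syms, termSyms]) (by simp [syms, termSyms])
  have hNS : (neg (allN (l.1 + 1) ψ)).syms ⊆ S := (syms_allN _ _).trans_subset hψS
  have h : cls Γ (allR l (neg (allN (l.1 + 1) ψ))) ∉ U := by
    rw [hU.mem_allR l _ hNS]
    intro h
    have := hF.mem_neg.1 (h m)
    rw [← Fml.instR, instR_var_eq_renR, renR_allN,
      hU.mem_allN_iff' ((syms_renR _ _).trans_subset hψS)] at this
    refine this fun x => ?_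
    have h0 : instRen l m (fun _ i => i) l 0 = m := by simp [instRen, consVal]
    have h1 : instRen l m (fun _ i => i) l (m + 1) = m := by simp [instRen, consVal]
    rw [hψ, renR, substR_iff, subst_iff, hF.mem_iff, substR, substR, h0, h1]
  rw [hU.mem_allR_defn l _ hNS] at h
  push Not at h
  obtain ⟨θ, hθ, z, h⟩ := h
  refine ⟨θ, hθ, fun i => hat U (z i), Set.ext fun d => ?_⟩
  obtain ⟨x, rfl⟩ := exists_eq_hat_comp d
  replace h := (not_iff_not.2 hF.mem_neg).1 h
  rw [not_not] at h
  change cls Γ (Fml.instR l _ (allN (l.1 + 1) ψ)) ∈ U at h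
  rw [Fml.instR, substR_allN, hψ, substR_iff, substR, substR] at h
  simp only [instSubstR, Function.update_self, consVal, RelExpr.shift, RelExpr.app,
    Term.relabel] at h
  rw [hU.mem_allN_iff' (syms_iff_subset (DefFormula.syms_app_subset (hS θ hθ) (fun _ => hvar _)
    fun _ => hvar _) (by simp [syms, termSyms]))] at h
  have hx := h x
  rw [subst_iff, hF.mem_iff, DefFormula.subst_app] at hx
  simp only [Fml.subst, Term.subst, preSubst_val, preSubst_add, id] at hx
  rw [hF.mem_canonicalRel_iff, ← hx, hU.mem_app_iff (hS θ hθ)]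
  rfl

theorem definableRels_eq_range (hU : IsGeneric S U)
    (hS : ∀ l, ∀ θ ∈ Θ l, formulaSyms θ.formula ⊆ S) (l : RelSort Θ) :
    definableRels Θ (CanonicalDomain U) l.1 = Set.range (canonicalRel U l) := by
  ext B
  constructor
  · rintro ⟨θ, hθ, e, rfl⟩
    obtain ⟨z, rfl⟩ := exists_eq_hat_comp e
    exact hU.exists_canonicalRel_eq l hθ (hS _ θ hθ) z
  · rintro ⟨m, rfl⟩
    exact hU.canonicalRel_mem_definableRels l (hS l.1) m

/-- The truth lemma. Elements are classes of variables and the relation quantifiers range over the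
`F_m`, so both semantic quantifiers run through the instances that `mem_all` and `mem_allR` test;
`x` and `ρ` vary because these steps change the assignment. -/
theorem sat_iff (hU : IsGeneric S U) (hS : ∀ l, ∀ θ ∈ Θ l, formulaSyms θ.formula ⊆ S)
    {φ : Fml Θ} (hφ : φ.syms ⊆ S) (x : ℕ → ℕ) (ρ : RelSort Θ → ℕ → ℕ) :
    Sat (definableRels Θ (CanonicalDomain U)) (fun i => hat U (x i))
        (fun k i => canonicalRel U k (ρ k i)) φ ↔
      cls Γ ((φ.renR ρ).subst fun i => Term.var (x i)) ∈ U := by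
  have hF := hU.isUltrafilter
  induction φ generalizing x ρ with
  | equal t s =>
    exact (hU.mem_equal_iff (Set.union_subset_iff.1 hφ).1 (Set.union_subset_iff.1 hφ).2 x).symm
  | rel R ts =>
    simp only [syms, Set.union_subset_iff, Set.iUnion_subset_iff] at hφ
    exact (hU.mem_rel_iff R hφ.2 x).symm
  | rvar l i ts =>
    simp only [syms, Set.iUnion_subset_iff] at hφ
    exact (hU.mem_rvar_iff l (ρ l i) hφ x).symm
  | req l i j => exact (hU.mem_req_iff l (ρ l i) (ρ l j)).symm
  | neg φ ih => exact (not_congr (ih hφ x ρ)).trans hF.mem_neg.symm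
  | and φ ψ ih ih' =>
    have h := Set.union_subset_iff.1 hφ
    exact (and_congr (ih h.1 x ρ) (ih' h.2 x ρ)).trans hF.mem_and.symm
  | all φ ih =>
    rw [Sat, renR_all, Fml.subst, hU.mem_all _ (syms_subst_subset (φ := φ.renR ρ)
      ((syms_renR _ _).trans_subset hφ) (termSyms_upSubst_subset fun _ => Set.empty_subset _)),
      hat_surjective.forall]
    refine forall_congr' fun m => ?_
    have h1 : consVal (hat U m) (fun i => hat U (x i)) = fun i => hat U (consVal m x i) := by
      funext i; cases i <;> rfl
    have h2 : (consVal (Term.var m) fun i => Term.var (L := L) (x i)) =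
        fun i => Term.var (consVal m x i) := by
      funext i; cases i <;> rfl
    rw [h1, inst_subst_upSubst, h2]
    exact ih hφ _ _
  | allR l φ ih =>
    rw [Sat, renR_allR, Fml.subst, hU.mem_allR _ _ (syms_subst_subset (φ := φ.renR (upRen l ρ))
      (σ := fun i => Term.var (x i)) ((syms_renR _ _).trans_subset hφ)
      fun _ => Set.empty_subset _),
      hU.definableRels_eq_range hS l, Set.forall_mem_range]
    refine forall_congr' fun m => ?_
    have h1 : consRel l (canonicalRel U l m) (fun k i => canonicalRel U k (ρ k i)) =
        fun k i => canonicalRel U k (instRen l m ρ k i) := by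
      funext k i
      by_cases hk : k = l
      · subst hk
        cases i <;> simp [consRel, instRen, consVal]
      · simp [consRel, instRen, hk]
    rw [h1, instR_var_eq_renR, ← renR_subst, ← instR_var_eq_renR, instR_renR_upRen]
    exact ih hφ _ _

theorem stdModels_of_forall_mem (hU : IsGeneric S U)
    (hS : ∀ l, ∀ θ ∈ Θ l, formulaSyms θ.formula ⊆ S) {φ : Fml Θ} (hφ : φ.syms ⊆ S)
    (h : ∀ (x : ℕ → ℕ) (ρ : RelSort Θ → ℕ → ℕ),
      cls Γ ((φ.renR ρ).subst fun i => Term.var (x i)) ∈ U) :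
    StdModels (CanonicalDomain U) φ := by
  intro s R hR
  obtain ⟨x, rfl⟩ := exists_eq_hat_comp s
  have : ∀ k i, ∃ m, canonicalRel U k m = R k i := fun k i => by
    rw [← Set.mem_range, ← hU.definableRels_eq_range hS]
    exact hR k i
  choose ρ hρ using this
  obtain rfl : (fun k i => canonicalRel U k (ρ k i)) = R := funext fun k => funext (hρ k)
  exact (hU.sat_iff hS hφ x ρ).2 (h x ρ)

/-- The assignment `x_i ↦ x̂_i`, `V_i ↦ F_i` refutes `φ`; it is admissible because every `F_i` is
definable. -/
theorem not_stdModels (hU : IsGeneric S U)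
    (hS : ∀ l, ∀ θ ∈ Θ l, formulaSyms θ.formula ⊆ S) {φ : Fml Θ} (hφ : φ.syms ⊆ S)
    (h : cls Γ φ ∉ U) : ¬ StdModels (CanonicalDomain U) φ := by
  intro H
  have := (hU.sat_iff hS hφ (fun i => i) fun _ i => i).1
    (H _ _ fun k i => hU.canonicalRel_mem_definableRels k (hS k.1) i)
  rw [renR_id] at this
  exact h (by rwa [φ.subst_var] at this)

end IsGeneric

end CanonicalModel

end RestrictedSO

/-! ### Model existence. -/

namespace RestrictedSO

variable {L : FirstOrder.Language.{u, v}} {Θ : DefClass L} {Γ : Set (Fml Θ)}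

/-- Lets a sentence ignore a renaming in all sorts at once, whereas `Provable.renR` renames within a
single sort. -/
theorem Fml.renR_congr {φ : Fml Θ} {ρ ρ' : RelSort Θ → ℕ → ℕ}
    (h : ∀ k i, (k, i) ∈ φ.freeRelVars → ρ k i = ρ' k i) : φ.renR ρ = φ.renR ρ' := by
  induction φ generalizing ρ ρ' with
  | equal => rfl
  | rel => rfl
  | rvar l i ts => simp only [renR, substR, h l i rfl]
  | req l i j => simp only [renR, substR, h l i (Or.inl rfl), h l j (Or.inr rfl)]
  | neg φ ih => exact congrArg neg (ih h)
  | and φ ψ ih ih' =>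
    exact congrArg₂ and (ih fun k i hi => h k i (Or.inl hi)) (ih' fun k i hi => h k i (Or.inr hi))
  | all φ ih => exact congrArg all (ih h)
  | allR l φ ih =>
    rw [renR_allR, renR_allR]
    refine congrArg _ (ih fun k i hi => ?_)
    by_cases hk : k = l
    · subst hk
      cases i with
      | zero => simp [upRen, consVal]
      | succ i =>
        have : ρ k i = ρ' k i := h k i (by simpa [freeRelVars] using hi)
        simp [upRen, consVal, this]
    · have : ρ k i = ρ' k i := h k i (by simpa [freeRelVars, hk] using hi)
      simp [upRen, hk, this]

theorem exists_countable_syms (hΘ : ∀ l, (Θ l).Countable) (hΓ : Γ.Countable) (φ : Fml Θ) :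
    ∃ S : Set L.Symbols, S.Countable ∧ (∀ l, ∀ θ ∈ Θ l, formulaSyms θ.formula ⊆ S) ∧
      (∀ ψ ∈ Γ, ψ.syms ⊆ S) ∧ φ.syms ⊆ S := by
  refine ⟨(⋃ l, ⋃ θ ∈ Θ l, formulaSyms θ.formula) ∪ (⋃ ψ ∈ Γ, ψ.syms) ∪ φ.syms, ?_, ?_, ?_,
    Set.subset_union_right⟩
  · exact ((Set.countable_iUnion fun l => (hΘ l).biUnion fun θ _ => countable_formulaSyms _).union
      (hΓ.biUnion fun ψ _ => ψ.countable_syms)).union φ.countable_syms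
  · exact fun l θ hθ s hs => Or.inl (Or.inl (Set.mem_iUnion.2 ⟨l, Set.mem_biUnion hθ hs⟩))
  · exact fun ψ hψ s hs => Or.inl (Or.inr (Set.mem_biUnion hψ hs))

/-- Model existence for the fragment with symbols in a countable set. -/
theorem exists_canonicalModel {S : Set L.Symbols} (hS : S.Countable)
    (hΘS : ∀ l, ∀ θ ∈ Θ l, formulaSyms θ.formula ⊆ S) (hΓS : ∀ ψ ∈ Γ, ψ.syms ⊆ S)
    (hΓs : ∀ ψ ∈ Γ, ψ.IsSentence) {φ : Fml Θ} (hφS : φ.syms ⊆ S) (hφ : ¬ Provable Γ φ) :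
    ∃ U : Set (Lindenbaum Γ), IsUltrafilter U ∧ IsCompatible (instFamilyOver Γ S) U ∧
      cls Γ φ ∉ U ∧
      (∀ l : RelSort Θ,
        definableRels Θ (CanonicalDomain U) l.1 = Set.range (canonicalRel U l)) ∧
      (∀ ψ ∈ Γ, StdModels (CanonicalDomain U) ψ) ∧ ¬ StdModels (CanonicalDomain U) φ := by
  have hne : cls Γ φ ≠ ⊤ := fun h => hφ <| by
    have h' : cls Γ Fml.top ≤ cls Γ φ := h.ge
    exact ((cls_le_cls Γ).1 h').mp (.gen (.ax (.eqRefl _)))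
  obtain ⟨U, hU, hc, hφU⟩ := exists_ultrafilter_isCompatible (countable_instFamilyOver Γ hS)
    (fun T hT => isRegularFamily_instFamily Γ T (instFamilyOver_subset Γ S hT)) hne
  have hG := hc.isGeneric hU
  refine ⟨U, hU, hc, hφU, hG.definableRels_eq_range hΘS, fun ψ hψ =>
    hG.stdModels_of_forall_mem hΘS (hΓS ψ hψ) fun x ρ => hU.mem_of_provable ?_,
    hG.not_stdModels hΘS hφS hφU⟩
  -- A premise is a sentence, so `ρ` acts trivially on it; the first-order substitution is absorbed
  -- by `Provable.subst`.
  rw [Fml.renR_congr (ρ' := fun _ i => i) fun k i hi => ?_, Fml.renR_id]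
  · exact (Provable.premise hψ).subst _
  · rw [(hΓs ψ hψ).2] at hi
    exact hi.elim

end RestrictedSO

theorem mainTheorem2 {L : FirstOrder.Language.{u, v}} (Θ : RestrictedSO.DefClass L)
    (hΘ : ∀ l, (Θ l).Countable)
    (Γ : Set (RestrictedSO.Fml Θ)) (hΓ : Γ.Countable) (hΓs : ∀ ψ ∈ Γ, ψ.IsSentence)
    (φ : RestrictedSO.Fml Θ) (hφs : φ.IsSentence)
    (hφ : ¬ RestrictedSO.Provable Γ φ) :
    (∃ (A : Type) (_ : L.Structure A) (_ : Nonempty A),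
      (∀ ψ ∈ Γ, RestrictedSO.StdModels A ψ) ∧ ¬ RestrictedSO.StdModels A φ) ∧
    (Countable L.Symbols →
      (RestrictedSO.instFamily Γ).Countable ∧
      RestrictedSO.IsRegularFamily (RestrictedSO.instFamily Γ) ∧
      ∃ U : Set (RestrictedSO.Lindenbaum Γ),
        RestrictedSO.IsUltrafilter U ∧
        RestrictedSO.IsCompatible (RestrictedSO.instFamily Γ) U ∧
        RestrictedSO.cls Γ φ ∉ U ∧
        (∀ l : RestrictedSO.RelSort Θ,
          RestrictedSO.definableRels Θ (RestrictedSO.CanonicalDomain U) l.1 =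
            Set.range (RestrictedSO.canonicalRel U l)) ∧
        (∀ ψ ∈ Γ, RestrictedSO.StdModels (RestrictedSO.CanonicalDomain U) ψ) ∧
        ¬ RestrictedSO.StdModels (RestrictedSO.CanonicalDomain U) φ) := by
  refine ⟨?_, fun _ => ?_⟩
  · obtain ⟨S, hS, hΘS, hΓS, hφS⟩ := RestrictedSO.exists_countable_syms hΘ hΓ φ
    obtain ⟨U, -, -, -, -, hUΓ, hUφ⟩ :=
      RestrictedSO.exists_canonicalModel hS hΘS hΓS hΓs hφS hφ
    exact ⟨RestrictedSO.CanonicalDomain U, inferInstance, inferInstance, hUΓ, hUφ⟩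
  -- With `L` countable all symbols can be admitted, so `U` respects the whole of `instFamily`.
  · have h : (Set.univ : Set L.Symbols).Countable := Set.countable_univ
    rw [← RestrictedSO.instFamilyOver_univ]
    refine ⟨RestrictedSO.countable_instFamilyOver Γ h, ?_,
      RestrictedSO.exists_canonicalModel h (fun _ _ _ => Set.subset_univ _)
        (fun _ _ => Set.subset_univ _) hΓs (Set.subset_univ _) hφ⟩
    rw [RestrictedSO.instFamilyOver_univ]
    exact RestrictedSO.isRegularFamily_instFamily Γ
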